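/- For a complex $N\times N$ matrix $A$ and $z\in\mathbb{C}\setminus\mathbb{R}$, let $m_A(z) := \frac1N \operatorname{Tr}\big((A-zI)^{-1}\big)$ be its Stieltjes transform (when $A-zI$ is invertible; this is always so for the real symmetric matrices below). Let $z\in\mathbb{C}\setminus\mathbb{R}$ and let $g:\mathbb{R}\to\mathbb{R}$ be three times differentiable with $g', g'', g'''$ bounded. Then there are constants $C_1, C_2$ depending only on $g$ and $z$ such that the following holds for every $N\ge 2$. Let $(\tilde X_{ij})_{1\le i\le j\le N}$ be an exchangeable collection of real random variables such that, almost surely, $$\frac{2}{N(N+1)}\sum_{1\le i\le j\le N}\tilde X_{ij}=0 \quad\text{and}\quad \frac{2}{N(N+1)}\sum_{1\le i\le j\le N}\tilde X_{ij}^2=1 .$$ Put $\tilde X_{ij}=\tilde X_{ji}$ for $i>j$ and $\tilde A_N=(N^{-1/2}\tilde X_{ij})_{1\le i,j\le N}$. Let $(Z_{ij})_{1\le i\le j\le N}$ be i.i.d. standard Gaussian random variables, let $\bar Z=\frac{2}{N(N+1)}\sum_{1\le i\le j\le N}Z_{ij}$, let $Y_{ij}=Z_{ij}-\bar Z$ for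 $i\le j$ and $Y_{ij}=Y_{ji}$ for $i>j$, and let $B_N=(N^{-1/2}Y_{ij})_{1\le i,j\le N}$. Then $$\big|\mathbb{E}\,g(\operatorname{Re} m_{\tilde A_N}(z))-\mathbb{E}\,g(\operatorname{Re} m_{B_N}(z))\big|\le C_1N^{-1}\big(\mathbb{E}|\tilde X_{12}|^4\big)^{1/2}+C_2N^{-1/2}\,\mathbb{E}|\tilde X_{12}|^3,$$ and $\big|\mathbb{E}\,g(\operatorname{Im} m_{\tilde A_N}(z))-\mathbb{E}\,g(\operatorname{Im} m_{B_N}(z))\big|$ admits the same upper bound. -/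

import Mathlib

open MeasureTheory ProbabilityTheory

/-- A finite family of real random variables is exchangeable: permuting the indices does not change
the joint law. (`IdentDistrib` contains the a.e.-measurability of the vectors involved.) -/
def Exchangeable {ι Ω : Type*} [Finite ι] [MeasurableSpace Ω] (X : ι → Ω → ℝ) (P : Measure Ω) :
    Prop :=
  ∀ π : Equiv.Perm ι, IdentDistrib (fun ω i => X (π i) ω) (fun ω i => X i ω) P P

/-- The index set `{(i, j) : i ≤ j}` of the entries on and above the diagonal. -/
abbrev UpperPair (N : ℕ) : Type := {p : Fin N × Fin N // p.1 ≤ p.2}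

/-- The position on or above the diagonal that determines the entry `(i, j)` of a symmetric matrix:
`(i, j)` itself if `i ≤ j`, and `(j, i)` otherwise. -/
def upperIndex {N : ℕ} (i j : Fin N) : UpperPair N :=
  if h : i ≤ j then ⟨(i, j), h⟩ else ⟨(j, i), (not_le.mp h).le⟩

/-- The average `2 / (N (N + 1)) * ∑_{i ≤ j} x_{ij}` over the entries on and above the diagonal. -/
noncomputable def upperMean {N : ℕ} (x : UpperPair N → ℝ) : ℝ :=
  2 / ((N : ℝ) * (N + 1)) * ∑ p, x p

/-- The real symmetric `N × N` matrix with entries `N^{-1/2} x_{ij}` for `i ≤ j` and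
`N^{-1/2} x_{ji}` for `i > j`, regarded as a complex matrix. -/
noncomputable def wignerMatrix {N : ℕ} (x : UpperPair N → ℝ) : Matrix (Fin N) (Fin N) ℂ :=
  Matrix.of fun i j => (((N : ℝ) ^ (-1 / 2 : ℝ) * x (upperIndex i j) : ℝ) : ℂ)

/-- The Stieltjes transform `N⁻¹ Tr ((A - z I)⁻¹)` of an `N × N` matrix. -/
noncomputable def stieltjes {N : ℕ} (A : Matrix (Fin N) (Fin N) ℂ) (z : ℂ) : ℂ :=
  (N : ℂ)⁻¹ * Matrix.trace (A - z • (1 : Matrix (Fin N) (Fin N) ℂ))⁻¹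

/-- The centred collection `Z_{ij} - Z̄`, where `Z̄` is the average of the `Z_{ij}`, `i ≤ j`. -/
noncomputable def centred {N : ℕ} (x : UpperPair N → ℝ) : UpperPair N → ℝ :=
  fun p => x p - upperMean x

/-! The proof is a Lindeberg replacement in which exchangeability stands in for independence. Take
the product of the law of `X` with the Gaussian product law and turn the coordinates of `x` into
those of `z` one at a time, through the hybrids `s.piecewise x z`. At a coordinate `i ∉ s`, expand
around the value 0. The Gaussian terms with `z i` and `z i ^ 2 - 1` vanish by independence. The
terms with `x i` and `x i ^ 2 - 1` do not vanish, but the coefficient sees only the `x`-coordinates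
in `s`, so `x i` may be averaged over the `m` indices outside `s`. Since the full sum is 0, distinct
coordinates are nonpositively correlated, and the average has size `m ^ (-1/2)`
(`abs_integral_mul_le_of_exchangeable`). Summing over `m = 1, …, n` costs only `2 √n`
(`abs_integral_sub_integral_pi_le`).

Here `n` is of order `N ^ 2`, and resolvent expansion gives coefficients of order `N ^ (-3/2)` and
`N ^ (-2)` and a cubic error of order `N ^ (-5/2)` (`hasCoordinateExpansion_comp_stieltjes`). The
three contributions are therefore of order `N ^ (-1/2)`, `N ^ (-1) * √(E X ^ 4)` and `N ^ (-1/2) * E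
|X| ^ 3`. Centring the Gaussians costs another `N ^ (-1/2)` (`norm_stieltjes_centred_sub_le`). As `E
X ^ 2 = 1` forces `E |X| ^ 3 ≥ 1`, the terms without a moment are absorbed into the last one. -/

lemma integral_abs_le_sqrt_integral_sq {α : Type*} [MeasurableSpace α] {μ : Measure α}
    [IsProbabilityMeasure μ] {S : α → ℝ} (hS : MemLp S 2 μ) :
    ∫ x, |S x| ∂μ ≤ √(∫ x, S x ^ 2 ∂μ) := by
  have h1 : MemLp (fun x => |S x|) 2 μ := hS.abs
  have h2 := variance_nonneg (fun x => |S x|) μ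
  rw [variance_eq_sub h1] at h2
  apply Real.le_sqrt_of_sq_le
  simpa [sq_abs] using h2

/-! ### Weak dependence of exchangeable coordinates with zero sum. -/

section Exchangeable

variable {ι : Type*} [DecidableEq ι] {μ : Measure (ι → ℝ)}

/-- Exchanging two coordinates does not change an integral against an exchangeable law. -/
lemma integral_comp_swap
    (hμ : ∀ π : Equiv.Perm ι, MeasurePreserving (fun (x : ι → ℝ) i => x (π i)) μ μ)
    (i k : ι) (F : (ι → ℝ) → ℝ) :
    ∫ x, F (fun j => x (Equiv.swap i k j)) ∂μ = ∫ x, F x ∂μ := by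
  have e := (MeasurableEquiv.piCongrLeft (fun _ : ι => ℝ) (Equiv.swap i k)).measurableEmbedding
  refine (hμ (Equiv.swap i k)).integral_comp ?_ F
  convert e using 1
  ext x j
  have := Equiv.piCongrLeft_apply_apply (fun _ : ι => ℝ) (Equiv.swap i k) x (Equiv.swap i k j)
  rw [Equiv.swap_apply_self] at this
  exact this.symm

variable [Fintype ι] [IsProbabilityMeasure μ] {u : ℝ → ℝ} {B : ℝ}

/-- Multiplying the zero sum by `u (x k)` and integrating gives `E u_k ^ 2 + (n - 1) E u_k u_l = 0`,
because all off-diagonal expectations agree. -/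
lemma integral_mul_nonpos_of_sum_eq_zero
    (hμ : ∀ π : Equiv.Perm ι, MeasurePreserving (fun (x : ι → ℝ) i => x (π i)) μ μ)
    (hu : Measurable u) (hB : ∀ᵐ x ∂μ, ∀ k, |u (x k)| ≤ B)
    (h0 : ∀ᵐ x ∂μ, ∑ k, u (x k) = 0) {k l : ι} (hkl : l ≠ k) :
    ∫ x, u (x k) * u (x l) ∂μ ≤ 0 := by
  have hint : ∀ a b, Integrable (fun x : ι → ℝ => u (x a) * u (x b)) μ := fun a b => by
    refine Integrable.of_bound (C := B * B) (by fun_prop) ?_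
    filter_upwards [hB] with x hx
    rw [norm_mul]
    exact mul_le_mul (hx a) (hx b) (norm_nonneg _) ((abs_nonneg _).trans (hx a))
  have hswap : ∀ j ∈ Finset.univ.erase k,
      ∫ x, u (x k) * u (x j) ∂μ = ∫ x, u (x k) * u (x l) ∂μ := fun j hj => by
    have hjk : j ≠ k := Finset.ne_of_mem_erase hj
    rw [← integral_comp_swap hμ l j]
    simp [Equiv.swap_apply_of_ne_of_ne hkl.symm hjk.symm]
  have hsum : ∑ j ∈ Finset.univ.erase k, ∫ x, u (x k) * u (x j) ∂μ
      = - ∫ x, u (x k) * u (x k) ∂μ := by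
    rw [← integral_finsetSum _ (fun j _ => hint k j), ← integral_neg]
    refine integral_congr_ae ?_
    filter_upwards [h0] with x hx
    rw [← Finset.mul_sum, ← Finset.sum_erase_add _ _ (Finset.mem_univ k)] at *
    linear_combination u (x k) * hx
  rw [Finset.sum_congr rfl hswap, Finset.sum_const, nsmul_eq_mul] at hsum
  have hpos : (0 : ℝ) < (Finset.univ.erase k).card := by
    exact_mod_cast Finset.card_pos.2 ⟨l, by simp [hkl]⟩
  have hsq : 0 ≤ ∫ x, u (x k) * u (x k) ∂μ := integral_nonneg fun x => mul_self_nonneg _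
  by_contra! h
  nlinarith [mul_pos hpos h]

/-- A bounded function of the coordinates in `s` is almost uncorrelated with a function of another
coordinate, if the latter functions add up to zero. -/
lemma abs_integral_mul_le_of_exchangeable
    (hμ : ∀ π : Equiv.Perm ι, MeasurePreserving (fun (x : ι → ℝ) i => x (π i)) μ μ)
    (hu : Measurable u) (hB : ∀ᵐ x ∂μ, ∀ k, |u (x k)| ≤ B)
    (h0 : ∀ᵐ x ∂μ, ∑ k, u (x k) = 0)
    {s : Finset ι} {i : ι} (hi : i ∉ s) {ψ : (ι → ℝ) → ℝ} (hψ : Measurable ψ) {L : ℝ}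
    (hL : ∀ x, |ψ x| ≤ L) (hψs : ∀ k ∉ s, ∀ x, ψ (fun j => x (Equiv.swap i k j)) = ψ x) :
    |∫ x, ψ x * u (x i) ∂μ| ≤ L * √(∫ x, u (x i) ^ 2 ∂μ) / √((sᶜ.card : ℕ) : ℝ) := by
  have hL0 : 0 ≤ L := (abs_nonneg _).trans (hL 0)
  set m : ℝ := ((sᶜ.card : ℕ) : ℝ) with hm
  have hmpos : 0 < m := by
    rw [hm]; exact_mod_cast Finset.card_pos.2 ⟨i, by simpa using hi⟩
  have hintu : ∀ a, Integrable (fun x : ι → ℝ => u (x a)) μ := fun a => by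
    refine Integrable.of_bound (C := B)
      (by fun_prop : Measurable fun x : ι → ℝ => u (x a)).aestronglyMeasurable ?_
    filter_upwards [hB] with x hx using hx a
  have hint : ∀ a b, Integrable (fun x : ι → ℝ => u (x a) * u (x b)) μ := fun a b => by
    refine (hintu b).bdd_mul (c := B)
      (by fun_prop : Measurable fun x : ι → ℝ => u (x a)).aestronglyMeasurable ?_
    filter_upwards [hB] with x hx using hx a
  have hintψ : ∀ a, Integrable (fun x : ι → ℝ => ψ x * u (x a)) μ := fun a =>
    (hintu a).bdd_mul (c := L) hψ.aestronglyMeasurable (.of_forall hL)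
  set S : (ι → ℝ) → ℝ := fun x => ∑ k ∈ sᶜ, u (x k) with hSdef
  have hSm : MemLp S 2 μ := by
    refine MemLp.of_bound (C := ∑ k ∈ sᶜ, B) (by fun_prop) ?_
    filter_upwards [hB] with x hx
    exact (norm_sum_le _ _).trans (Finset.sum_le_sum fun k _ => hx k)
  -- `ψ` does not notice a swap of `i` with an index outside `s`, so each of the `m` indices there
  -- contributes the same integral.
  have hS1 : m * ∫ x, ψ x * u (x i) ∂μ = ∫ x, ψ x * S x ∂μ := by
    have : ∀ k ∈ sᶜ, ∫ x, ψ x * u (x k) ∂μ = ∫ x, ψ x * u (x i) ∂μ := fun k hk => by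
      rw [← integral_comp_swap hμ i k]
      simp [hψs k (by simpa using hk)]
    simp only [hSdef, Finset.mul_sum]
    rw [integral_finsetSum _ (fun k _ => hintψ k), Finset.sum_congr rfl this]
    simp [hm]
  -- Off-diagonal terms are nonpositive, so only the `m` diagonal ones count: this is the saving of
  -- `√m`.
  have hS2 : ∫ x, S x ^ 2 ∂μ ≤ m * ∫ x, u (x i) ^ 2 ∂μ := by
    have hdiag : ∀ k, ∫ x, u (x k) * u (x k) ∂μ = ∫ x, u (x i) ^ 2 ∂μ := fun k => by
      rw [← integral_comp_swap hμ i k]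
      simp [sq]
    calc ∫ x, S x ^ 2 ∂μ = ∑ k ∈ sᶜ, ∑ l ∈ sᶜ, ∫ x, u (x k) * u (x l) ∂μ := by
          simp only [hSdef, sq, Finset.sum_mul_sum]
          rw [integral_finsetSum _ fun k _ => integrable_finsetSum _ fun l _ => hint k l]
          exact Finset.sum_congr rfl fun k _ => integral_finsetSum _ fun l _ => hint k l
      _ ≤ ∑ k ∈ sᶜ, ∫ x, u (x i) ^ 2 ∂μ := by
          refine Finset.sum_le_sum fun k hk => ?_
          rw [← Finset.add_sum_erase _ _ hk, hdiag k]
          refine add_le_of_nonpos_right (Finset.sum_nonpos fun l hl => ?_)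
          exact integral_mul_nonpos_of_sum_eq_zero hμ hu hB h0 (Finset.ne_of_mem_erase hl)
      _ = m * ∫ x, u (x i) ^ 2 ∂μ := by simp [hm]
  have hS3 : |∫ x, ψ x * S x ∂μ| ≤ L * √(m * ∫ x, u (x i) ^ 2 ∂μ) := by
    calc |∫ x, ψ x * S x ∂μ| ≤ ∫ x, L * |S x| ∂μ := by
          rw [← Real.norm_eq_abs]
          refine norm_integral_le_of_norm_le ((hSm.integrable one_le_two).abs.const_mul L)
            (.of_forall fun x => ?_)
          rw [norm_mul]
          exact mul_le_mul_of_nonneg_right (hL x) (abs_nonneg _)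
      _ ≤ _ := by
          rw [integral_const_mul]
          gcongr
          exact (integral_abs_le_sqrt_integral_sq hSm).trans (Real.sqrt_le_sqrt hS2)
  rw [← hS1, abs_mul, abs_of_pos hmpos, Real.sqrt_mul hmpos.le] at hS3
  have hsm := Real.sqrt_pos.2 hmpos
  rw [le_div_iff₀ hsm]
  refine le_of_mul_le_mul_left ?_ hsm
  calc _ = m * |∫ x, ψ x * u (x i) ∂μ| := by
        rw [mul_left_comm, Real.mul_self_sqrt hmpos.le, mul_comm]
    _ ≤ _ := by linarith

end Exchangeable

/-- `f` has a second order expansion in each coordinate around the value `0` of that coordinate,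
with coefficients `a` and `b` that do not depend on the coordinate and a cubic error. -/
structure HasCoordinateExpansion {ι : Type*} [DecidableEq ι] (f : (ι → ℝ) → ℝ)
    (a b : ι → (ι → ℝ) → ℝ) (L₁ L₂ L₃ : ℝ) : Prop where
  measurable_fst : ∀ i, Measurable (a i)
  measurable_snd : ∀ i, Measurable (b i)
  fst_update : ∀ i x t, a i (Function.update x i t) = a i x
  snd_update : ∀ i x t, b i (Function.update x i t) = b i x
  abs_fst_le : ∀ i x, |a i x| ≤ L₁
  abs_snd_le : ∀ i x, |b i x| ≤ L₂
  abs_sub_le : ∀ i x, |f x - f (Function.update x i 0) - a i x * x i - b i x * x i ^ 2| ≤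
    L₃ * |x i| ^ 3

/-! ### The Lindeberg replacement for exchangeable laws. -/

section Lindeberg

lemma ae_abs_le_sqrt_card {ι : Type*} [Fintype ι] {μ : Measure (ι → ℝ)}
    (h₂ : ∀ᵐ x ∂μ, ∑ k, x k ^ 2 = (Fintype.card ι : ℝ)) :
    ∀ᵐ x ∂μ, ∀ k, |x k| ≤ √(Fintype.card ι : ℝ) := by
  filter_upwards [h₂] with x hx k
  apply Real.le_sqrt_of_sq_le
  rw [sq_abs, ← hx]
  exact Finset.single_le_sum (f := fun k => x k ^ 2) (fun _ _ => sq_nonneg _) (Finset.mem_univ k)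

lemma integrable_pow_of_sum_sq_eq_card {ι : Type*} [Fintype ι] {μ : Measure (ι → ℝ)}
    [IsFiniteMeasure μ]
    (h₂ : ∀ᵐ x ∂μ, ∑ k, x k ^ 2 = (Fintype.card ι : ℝ)) (i : ι) (r : ℕ) :
    Integrable (fun x : ι → ℝ => x i ^ r) μ := by
  refine Integrable.of_bound (C := √(Fintype.card ι : ℝ) ^ r)
    ((measurable_pi_apply i).pow_const r).aestronglyMeasurable ?_
  filter_upwards [ae_abs_le_sqrt_card h₂] with x hx
  rw [norm_pow]
  exact pow_le_pow_left₀ (norm_nonneg _) (hx i) r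

variable {ι : Type*} [DecidableEq ι]

lemma measurable_piecewise_prod (s : Finset ι) :
    Measurable fun p : (ι → ℝ) × (ι → ℝ) => s.piecewise p.1 p.2 := by
  refine measurable_pi_lambda _ fun j => ?_
  by_cases hj : j ∈ s <;> simp only [Finset.piecewise, hj, if_true, if_false] <;> fun_prop

variable [Fintype ι] {γ : Measure ℝ} [IsProbabilityMeasure γ]

lemma integral_mul_pi_of_forall_update {φ : (ι → ℝ) → ℝ} (hφ : Measurable φ) {i : ι}
    (hφi : ∀ x t, φ (Function.update x i t) = φ x) {v : ℝ → ℝ} (hv : Measurable v)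
    (hv0 : ∫ t, v t ∂γ = 0) :
    ∫ z, φ z * v (z i) ∂Measure.pi (fun _ : ι => γ) = 0 := by
  have hind : iIndepFun (fun (j : ι) (z : ι → ℝ) => z j) (Measure.pi fun _ : ι => γ) :=
    iIndepFun_pi (X := fun _ t => t) (fun _ => aemeasurable_id)
  have h := hind.indepFun_finset {i}ᶜ {i} disjoint_compl_left (fun j => measurable_pi_apply j)
  -- Freezing coordinate `i` at 0 exhibits `φ` as a function of the other coordinates, hence
  -- independent of `z i`.
  set φ' : (({i}ᶜ : Finset ι) → ℝ) → ℝ :=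
    fun y => φ fun j => if hj : j ∈ ({i}ᶜ : Finset ι) then y ⟨j, hj⟩ else 0 with hφ'
  have hφ'm : Measurable φ' := by
    refine hφ.comp (measurable_pi_lambda _ fun j => ?_)
    split_ifs <;> fun_prop
  have hcomp := h.comp (φ := φ') 
    (ψ := fun y : ({i} : Finset ι) → ℝ => v (y ⟨i, Finset.mem_singleton_self i⟩)) hφ'm
    (hv.comp (measurable_pi_apply _))
  have heq : ∀ z : ι → ℝ, φ' (fun j => z j) = φ z := fun z => by
    rw [hφ', ← hφi z 0]
    refine congrArg φ (funext fun j => ?_)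
    by_cases hj : j = i
    · subst hj; simp
    · simp [hj]
  have hmul := hcomp.integral_fun_mul_eq_mul_integral
    (hφ'm.comp (by fun_prop)).aestronglyMeasurable
    (hv.comp (measurable_pi_apply i)).aestronglyMeasurable
  simp only [Function.comp_def, heq] at hmul
  rw [hmul]
  rw [integral_comp_eval (μ := fun _ : ι => γ) hv.aestronglyMeasurable, hv0, mul_zero]

lemma integral_sq_eq_one_of_exchangeable {μ : Measure (ι → ℝ)} [IsProbabilityMeasure μ]
    (hμ : ∀ π : Equiv.Perm ι, MeasurePreserving (fun (x : ι → ℝ) i => x (π i)) μ μ)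
    (h₂ : ∀ᵐ x ∂μ, ∑ k, x k ^ 2 = (Fintype.card ι : ℝ)) (i : ι) :
    ∫ x, x i ^ 2 ∂μ = 1 := by
  have h : ∀ k, ∫ x, x k ^ 2 ∂μ = ∫ x, x i ^ 2 ∂μ := fun k => by
    rw [← integral_comp_swap hμ i k]
    simp
  have h3 : ∫ x, ∑ k, x k ^ 2 ∂μ = Fintype.card ι := by
    rw [integral_congr_ae h₂]; simp
  rw [integral_finsetSum _ fun k _ => integrable_pow_of_sum_sq_eq_card h₂ k 2,
    Finset.sum_congr rfl fun k _ => h k] at h3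
  have hn0 : (Fintype.card ι : ℝ) ≠ 0 := by
    exact_mod_cast (Fintype.card_pos_iff.2 ⟨i⟩).ne'
  simpa [hn0] using h3

variable {μ : Measure (ι → ℝ)} [IsProbabilityMeasure μ] {φ : (ι → ℝ) → ℝ} {L : ℝ} {i : ι}
  {s : Finset ι}

/-- For fixed `z`, the map `x ↦ φ (s.piecewise x z)` depends only on the coordinates in `s`, so the
exchangeable bound applies uniformly in `z`. -/
lemma abs_integral_piecewise_mul_fst_le
    (hμ : ∀ π : Equiv.Perm ι, MeasurePreserving (fun (x : ι → ℝ) i => x (π i)) μ μ)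
    {u : ℝ → ℝ} {B : ℝ} (hu : Measurable u) (hB : ∀ᵐ x ∂μ, ∀ k, |u (x k)| ≤ B)
    (h0 : ∀ᵐ x ∂μ, ∑ k, u (x k) = 0) (hi : i ∉ s) (hφ : Measurable φ) (hL : ∀ x, |φ x| ≤ L) :
    |∫ p, φ (s.piecewise p.1 p.2) * u (p.1 i) ∂μ.prod (Measure.pi fun _ : ι => γ)| ≤
      L * √(∫ x, u (x i) ^ 2 ∂μ) / √((sᶜ.card : ℕ) : ℝ) := by
  have hint : Integrable (fun p : (ι → ℝ) × (ι → ℝ) => φ (s.piecewise p.1 p.2) * u (p.1 i))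
      (μ.prod (Measure.pi fun _ : ι => γ)) := by
    refine Integrable.bdd_mul (c := L) ?_
      (hφ.comp (measurable_piecewise_prod s)).aestronglyMeasurable (.of_forall fun _ => hL _)
    refine Integrable.comp_fst (f := fun x : ι → ℝ => u (x i)) ?_ _
    refine Integrable.of_bound (C := B) (hu.comp (measurable_pi_apply i)).aestronglyMeasurable ?_
    filter_upwards [hB] with x hx using hx i
  rw [integral_prod_symm _ hint, ← Real.norm_eq_abs]
  refine (norm_integral_le_of_norm_le_const (.of_forall fun z => ?_)).trans_eq
    (by rw [probReal_univ, mul_one])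
  refine abs_integral_mul_le_of_exchangeable hμ hu hB h0 hi
    (ψ := fun x => φ (s.piecewise x z)) ?_ (fun _ => hL _) fun k hk x => ?_
  · exact hφ.comp ((measurable_piecewise_prod s).comp (by fun_prop : Measurable fun x => (x, z)))
  · congr 1
    ext j
    by_cases hj : j ∈ s
    · have h1 : j ≠ i := fun h => hi (h ▸ hj)
      have h2 : j ≠ k := fun h => hk (h ▸ hj)
      simp [hj, Equiv.swap_apply_of_ne_of_ne h1 h2]
    · simp [hj]

lemma integral_piecewise_mul_snd_eq_zero {v : ℝ → ℝ} (hv : Measurable v) (hvi : Integrable v γ)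
    (hv0 : ∫ t, v t ∂γ = 0) (hi : i ∉ s) (hφ : Measurable φ) (hL : ∀ x, |φ x| ≤ L)
    (hφi : ∀ x t, φ (Function.update x i t) = φ x) :
    ∫ p, φ (s.piecewise p.1 p.2) * v (p.2 i) ∂μ.prod (Measure.pi fun _ : ι => γ) = 0 := by
  have hint : Integrable (fun p : (ι → ℝ) × (ι → ℝ) => φ (s.piecewise p.1 p.2) * v (p.2 i))
      (μ.prod (Measure.pi fun _ : ι => γ)) := by
    refine Integrable.bdd_mul (c := L) ?_
      (hφ.comp (measurable_piecewise_prod s)).aestronglyMeasurable (.of_forall fun _ => hL _)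
    refine Integrable.comp_snd (f := fun x : ι → ℝ => v (x i)) ?_ _
    exact (measurePreserving_eval (fun _ : ι => γ) i).integrable_comp_of_integrable hvi
  rw [integral_prod _ hint]
  refine integral_eq_zero_of_ae (.of_forall fun x => ?_)
  refine integral_mul_pi_of_forall_update (φ := fun z => φ (s.piecewise x z)) ?_ (fun z t => ?_)
    hv hv0
  · exact hφ.comp ((measurable_piecewise_prod s).comp (by fun_prop : Measurable fun z => (x, z)))
  · rw [← hφi (s.piecewise x z) t, s.update_piecewise_of_notMem x z hi]


/-- The two hybrids differ only at `i`, so both expand around the same point with the same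
coefficients. Subtracting leaves `a (x i - z i)`, `b ((x i ^ 2 - 1) - (z i ^ 2 - 1))` and two cubic
errors. -/
lemma abs_integral_piecewise_insert_sub_le
    (hμ : ∀ π : Equiv.Perm ι, MeasurePreserving (fun (x : ι → ℝ) i => x (π i)) μ μ)
    (h₁ : ∀ᵐ x ∂μ, ∑ k, x k = 0) (h₂ : ∀ᵐ x ∂μ, ∑ k, x k ^ 2 = (Fintype.card ι : ℝ))
    (hγ : MemLp id 3 γ) (hγ₁ : ∫ t, t ∂γ = 0) (hγ₂ : ∫ t, t ^ 2 ∂γ = 1)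
    {f : (ι → ℝ) → ℝ} (hf : Measurable f) {M : ℝ} (hM : ∀ x, |f x| ≤ M)
    {a b : ι → (ι → ℝ) → ℝ} {L₁ L₂ L₃ : ℝ} (hab : HasCoordinateExpansion f a b L₁ L₂ L₃)
    (hi : i ∉ s) :
    |∫ p, f ((insert i s).piecewise p.1 p.2) ∂μ.prod (Measure.pi fun _ : ι => γ) -
      ∫ p, f (s.piecewise p.1 p.2) ∂μ.prod (Measure.pi fun _ : ι => γ)| ≤
      (L₁ + L₂ * √(∫ x, x i ^ 4 ∂μ)) / √((sᶜ.card : ℕ) : ℝ) +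
        L₃ * (∫ x, |x i| ^ 3 ∂μ + ∫ t, |t| ^ 3 ∂γ) := by
  set ν := Measure.pi fun _ : ι => γ with hν
  set n : ℝ := (Fintype.card ι : ℝ) with hn
  have hL₂ : 0 ≤ L₂ := (abs_nonneg _).trans (hab.abs_snd_le i 0)
  -- The bounds `√n` and `n + 1` only secure integrability; they do not enter the estimate.
  have hB : ∀ᵐ x ∂μ, ∀ k, |x k| ≤ √n := ae_abs_le_sqrt_card h₂
  have hBq : ∀ᵐ x ∂μ, ∀ k, |x k ^ 2 - 1| ≤ n + 1 := by
    filter_upwards [hB] with x hx k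
    have : x k ^ 2 ≤ n := by
      rw [← sq_abs, ← Real.sq_sqrt (hn ▸ Nat.cast_nonneg (Fintype.card ι) : (0 : ℝ) ≤ n)]
      gcongr
      exact hx k
    rw [abs_le]
    constructor <;> nlinarith [sq_nonneg (x k)]
  have hsumq : ∀ᵐ x ∂μ, ∑ k, (x k ^ 2 - 1) = 0 := by
    filter_upwards [h₂] with x hx
    simp [hx, ← hn]
  have hpow := integrable_pow_of_sum_sq_eq_card h₂ i
  have hγi : ∀ r ≤ 3, Integrable (fun t : ℝ => |t| ^ r) γ := fun r hr => by
    have := (hγ.mono_exponent (p := r) (by exact_mod_cast hr)).integrable_norm_pow'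
    simpa using this
  have hγ1 : Integrable (fun t : ℝ => t) γ :=
    (integrable_norm_iff (by fun_prop)).1 (by simpa using hγi 1 (by norm_num))
  have hγ2 : Integrable (fun t : ℝ => t ^ 2) γ := by simpa using hγi 2 (by norm_num)
  have hx2 := integral_sq_eq_one_of_exchangeable hμ h₂ i
  have hx4 : ∫ x, (x i ^ 2 - 1) ^ 2 ∂μ ≤ ∫ x, x i ^ 4 ∂μ := by
    have : ∀ x : ι → ℝ, (x i ^ 2 - 1) ^ 2 = x i ^ 4 - 2 * x i ^ 2 + 1 := fun x => by ring
    simp only [this]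
    rw [integral_add (show Integrable (fun x : ι → ℝ => x i ^ 4 - 2 * x i ^ 2) μ from
      (hpow 4).sub ((hpow 2).const_mul 2)) (integrable_const _),
      integral_sub (hpow 4) ((hpow 2).const_mul 2), integral_const_mul, hx2, integral_const, probReal_univ]
    norm_num
    linarith
  have hpm := measurable_piecewise_prod s
  have hbdd : ∀ {c : (ι → ℝ) → ℝ} {L : ℝ}, Measurable c → (∀ x, |c x| ≤ L) →
      ∀ {h : (ι → ℝ) × (ι → ℝ) → ℝ}, Integrable h (μ.prod ν) →
      Integrable (fun p => c (s.piecewise p.1 p.2) * h p) (μ.prod ν) := fun hc hcL _ hh =>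
    hh.bdd_mul (hc.comp hpm).aestronglyMeasurable (.of_forall fun _ => hcL _)
  have hfst : ∀ {v : ℝ → ℝ}, Integrable (fun x : ι → ℝ => v (x i)) μ →
      Integrable (fun p : (ι → ℝ) × (ι → ℝ) => v (p.1 i)) (μ.prod ν) := fun h => h.comp_fst _
  have hsnd : ∀ {v : ℝ → ℝ}, Integrable v γ →
      Integrable (fun p : (ι → ℝ) × (ι → ℝ) => v (p.2 i)) (μ.prod ν) := fun {v} h =>
    Integrable.comp_snd (f := fun z : ι → ℝ => v (z i))
      ((measurePreserving_eval (fun _ : ι => γ) i).integrable_comp_of_integrable h) _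
  have hfi : ∀ t : Finset ι, Integrable (fun p : (ι → ℝ) × (ι → ℝ) => f (t.piecewise p.1 p.2))
      (μ.prod ν) := fun t =>
    Integrable.of_bound (C := M) (hf.comp (measurable_piecewise_prod t)).aestronglyMeasurable
      (.of_forall fun _ => hM _)
  have hq : Integrable (fun x : ι → ℝ => x i ^ 2 - 1) μ := (hpow 2).sub (integrable_const _)
  have hqγ : Integrable (fun t : ℝ => t ^ 2 - 1) γ := hγ2.sub (integrable_const _)
  have hqγ0 : ∫ t, (t ^ 2 - 1) ∂γ = 0 := by
    rw [integral_sub hγ2 (integrable_const _), hγ₂]; simp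
  have iT1 := hbdd (hab.measurable_fst i) (hab.abs_fst_le i)
    (hfst (v := fun t => t) (by simpa using hpow 1))
  have iT2 := hbdd (hab.measurable_fst i) (hab.abs_fst_le i) (hsnd hγ1)
  have iT3 := hbdd (hab.measurable_snd i) (hab.abs_snd_le i) (hfst (v := fun t => t ^ 2 - 1) hq)
  have iT4 := hbdd (hab.measurable_snd i) (hab.abs_snd_le i) (hsnd hqγ)
  have T1 := abs_integral_piecewise_mul_fst_le (γ := γ) hμ measurable_id hB h₁ hi
    (hab.measurable_fst i) (hab.abs_fst_le i)
  have T2 := integral_piecewise_mul_snd_eq_zero (μ := μ) measurable_id hγ1 hγ₁ hi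
    (hab.measurable_fst i) (hab.abs_fst_le i) (hab.fst_update i)
  have T3 := abs_integral_piecewise_mul_fst_le (γ := γ) hμ (u := fun t => t ^ 2 - 1)
    (by fun_prop) hBq hsumq hi (hab.measurable_snd i) (hab.abs_snd_le i)
  have T4 := integral_piecewise_mul_snd_eq_zero (μ := μ) (v := fun t => t ^ 2 - 1)
    (by fun_prop) hqγ hqγ0 hi (hab.measurable_snd i) (hab.abs_snd_le i) (hab.snd_update i)
  simp only [id_eq, hx2, Real.sqrt_one, mul_one, ← hν] at T1 T2 T3 T4
  have iT12 : Integrable (fun p : (ι → ℝ) × (ι → ℝ) =>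
      a i (s.piecewise p.1 p.2) * p.1 i - a i (s.piecewise p.1 p.2) * p.2 i) (μ.prod ν) :=
    iT1.sub iT2
  have iT123 : Integrable (fun p : (ι → ℝ) × (ι → ℝ) =>
      a i (s.piecewise p.1 p.2) * p.1 i - a i (s.piecewise p.1 p.2) * p.2 i +
        b i (s.piecewise p.1 p.2) * (p.1 i ^ 2 - 1)) (μ.prod ν) := iT12.add iT3
  have iA : Integrable (fun p : (ι → ℝ) × (ι → ℝ) =>
      a i (s.piecewise p.1 p.2) * p.1 i - a i (s.piecewise p.1 p.2) * p.2 i +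
        b i (s.piecewise p.1 p.2) * (p.1 i ^ 2 - 1) -
        b i (s.piecewise p.1 p.2) * (p.2 i ^ 2 - 1)) (μ.prod ν) := iT123.sub iT4
  have iD : Integrable (fun p : (ι → ℝ) × (ι → ℝ) =>
      f ((insert i s).piecewise p.1 p.2) - f (s.piecewise p.1 p.2)) (μ.prod ν) :=
    (hfi _).sub (hfi _)
  have hR : ∀ p : (ι → ℝ) × (ι → ℝ),
      ‖f ((insert i s).piecewise p.1 p.2) - f (s.piecewise p.1 p.2) -
        (a i (s.piecewise p.1 p.2) * p.1 i - a i (s.piecewise p.1 p.2) * p.2 i +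
        b i (s.piecewise p.1 p.2) * (p.1 i ^ 2 - 1) -
        b i (s.piecewise p.1 p.2) * (p.2 i ^ 2 - 1))‖ ≤
      L₃ * (|p.1 i| ^ 3 + |p.2 i| ^ 3) := fun p => by
    have e1 := hab.abs_sub_le i ((insert i s).piecewise p.1 p.2)
    have e2 := hab.abs_sub_le i (s.piecewise p.1 p.2)
    rw [Finset.piecewise_insert] at e1 ⊢
    simp only [Function.update_idem, Function.update_self, hab.fst_update, hab.snd_update] at e1
    rw [Finset.piecewise_eq_of_notMem _ _ _ hi] at e2
    rw [abs_le] at e1 e2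
    rw [Real.norm_eq_abs, abs_le]
    constructor <;> linarith
  have iR : Integrable (fun p : (ι → ℝ) × (ι → ℝ) => L₃ * (|p.1 i| ^ 3 + |p.2 i| ^ 3))
      (μ.prod ν) :=
    ((hfst (v := fun t => |t| ^ 3) (by simpa using (hpow 3).abs)).add
      (hsnd (hγi 3 le_rfl))).const_mul L₃
  have hRint := norm_integral_le_of_norm_le iR (.of_forall hR)
  have hRval : ∫ p : (ι → ℝ) × (ι → ℝ), L₃ * (|p.1 i| ^ 3 + |p.2 i| ^ 3) ∂μ.prod ν =
      L₃ * (∫ x, |x i| ^ 3 ∂μ + ∫ t, |t| ^ 3 ∂γ) := by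
    rw [integral_const_mul, integral_add
      (hfst (v := fun t => |t| ^ 3) (by simpa using (hpow 3).abs)) (hsnd (hγi 3 le_rfl)),
      integral_fun_fst (f := fun x : ι → ℝ => |x i| ^ 3),
      integral_fun_snd (f := fun x : ι → ℝ => |x i| ^ 3),
      integral_comp_eval (μ := fun _ : ι => γ) (f := fun t => |t| ^ 3) (by fun_prop)]
    simp
  rw [integral_sub iD iA, integral_sub (hfi _) (hfi _), integral_sub iT123 iT4,
    integral_add iT12 iT3, integral_sub iT1 iT2, T2, T4, hRval, Real.norm_eq_abs] at hRint
  have T3' := T3.trans (show _ ≤ L₂ * √(∫ x, x i ^ 4 ∂μ) / √((sᶜ.card : ℕ) : ℝ) by gcongr)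
  rw [add_div]
  rw [abs_le] at *
  constructor <;> linarith

/-- Telescoping: `1 / √(n + 1) ≤ 2 (√(n + 1) - √n)`, which amounts to `(√(n + 1) - √n) ^ 2 ≥ 0`. -/
lemma sum_range_inv_sqrt_le (n : ℕ) : ∑ k ∈ Finset.range n, (√((k + 1 : ℕ) : ℝ))⁻¹ ≤ 2 * √n := by
  induction n with
  | zero => simp
  | succ n ih =>
    rw [Finset.sum_range_succ]
    have h0 : 0 < √((n + 1 : ℕ) : ℝ) := Real.sqrt_pos.2 (by positivity)
    have h1 := Real.sqrt_nonneg (n : ℝ)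
    have h2 := Real.sq_sqrt (Nat.cast_nonneg n : (0 : ℝ) ≤ n)
    have h3 := Real.sq_sqrt (Nat.cast_nonneg (n + 1) : (0 : ℝ) ≤ (n + 1 : ℕ))
    have h4 : (√((n + 1 : ℕ) : ℝ))⁻¹ ≤ 2 * √((n + 1 : ℕ) : ℝ) - 2 * √n := by
      rw [inv_le_iff_one_le_mul₀ h0]
      push_cast at *
      nlinarith [sq_nonneg (√((n : ℝ) + 1) - √n)]
    linarith

/-- The Lindeberg principle for an exchangeable law with deterministic sum and sum of squares. -/
theorem abs_integral_sub_integral_pi_le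
    (hμ : ∀ π : Equiv.Perm ι, MeasurePreserving (fun (x : ι → ℝ) i => x (π i)) μ μ)
    (h₁ : ∀ᵐ x ∂μ, ∑ k, x k = 0) (h₂ : ∀ᵐ x ∂μ, ∑ k, x k ^ 2 = (Fintype.card ι : ℝ))
    (hγ : MemLp id 3 γ) (hγ₁ : ∫ t, t ∂γ = 0) (hγ₂ : ∫ t, t ^ 2 ∂γ = 1)
    {f : (ι → ℝ) → ℝ} (hf : Measurable f) {M : ℝ} (hM : ∀ x, |f x| ≤ M)
    {a b : ι → (ι → ℝ) → ℝ} {L₁ L₂ L₃ : ℝ} (hab : HasCoordinateExpansion f a b L₁ L₂ L₃)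
    (i : ι) :
    |∫ x, f x ∂μ - ∫ z, f z ∂Measure.pi fun _ : ι => γ| ≤
      (L₁ + L₂ * √(∫ x, x i ^ 4 ∂μ)) * (2 * √(Fintype.card ι)) +
        Fintype.card ι * (L₃ * (∫ x, |x i| ^ 3 ∂μ + ∫ t, |t| ^ 3 ∂γ)) := by
  set H : Finset ι → ℝ := fun s =>
    ∫ p, f (s.piecewise p.1 p.2) ∂μ.prod (Measure.pi fun _ : ι => γ) with hH
  set K := L₁ + L₂ * √(∫ x, x i ^ 4 ∂μ) with hK
  set R := L₃ * (∫ x, |x i| ^ 3 ∂μ + ∫ t, |t| ^ 3 ∂γ) with hR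
  have hL₁ : 0 ≤ L₁ := (abs_nonneg _).trans (hab.abs_fst_le i 0)
  have hL₂ : 0 ≤ L₂ := (abs_nonneg _).trans (hab.abs_snd_le i 0)
  have hstep : ∀ (s : Finset ι) (k : ι), k ∉ s →
      |H (insert k s) - H s| ≤ K * (√((sᶜ.card : ℕ) : ℝ))⁻¹ + R := fun s k hk => by
    have h := abs_integral_piecewise_insert_sub_le hμ h₁ h₂ hγ hγ₁ hγ₂ hf hM hab hk
    have e : ∀ F : ℝ → ℝ, ∫ x, F (x k) ∂μ = ∫ x, F (x i) ∂μ := fun F => by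
      rw [← integral_comp_swap hμ i k]
      simp
    rwa [e (fun t => t ^ 4), e (fun t => |t| ^ 3), div_eq_mul_inv] at h
  -- `s` is the set of coordinates already replaced. Replacing one more leaves `(insert k s)ᶜ`,
  -- whose complement has `s.card + 1` elements; hence the `k + 1` under the root.
  have hind : ∀ s : Finset ι, |H Finset.univ - H sᶜ| ≤
      K * ∑ k ∈ Finset.range s.card, (√((k + 1 : ℕ) : ℝ))⁻¹ + s.card * R := fun s => by
    induction s using Finset.induction_on with
    | empty => simp
    | insert k s hk ih =>
      have h := hstep (insert k s)ᶜ k (by simp)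
      have e : insert k (insert k s)ᶜ = sᶜ := by
        ext j; by_cases hj : j = k <;> simp [hj, hk]
      rw [e, compl_compl, Finset.card_insert_of_notMem hk] at h
      rw [Finset.card_insert_of_notMem hk, Finset.sum_range_succ]
      have := abs_sub_le (H Finset.univ) (H sᶜ) (H (insert k s)ᶜ)
      push_cast at *
      linarith
  have h := hind Finset.univ
  have e1 : H Finset.univ = ∫ x, f x ∂μ := by
    simp only [hH, Finset.piecewise_univ]
    rw [integral_fun_fst (f := f)]
    simp
  have e2 : H Finset.univᶜ = ∫ z, f z ∂Measure.pi fun _ : ι => γ := by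
    simp only [hH, Finset.compl_univ, Finset.piecewise_empty]
    rw [integral_fun_snd (f := f)]
    simp
  rw [e1, e2, Finset.card_univ] at h
  have hs := sum_range_inv_sqrt_le (Fintype.card ι)
  have hK0 : 0 ≤ K := by positivity
  nlinarith [mul_le_mul_of_nonneg_left hs hK0]

end Lindeberg

/-! ### Taylor estimates for `g`. -/

/-- The mean value inequality on `[-|x|, |x|]` needs no integrability of `h'`; the price is the lost
factor `1 / (k + 1)`. -/
lemma abs_le_mul_pow_succ_of_hasDerivAt {h h' : ℝ → ℝ} (hd : ∀ x, HasDerivAt h (h' x) x)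
    (h0 : h 0 = 0) {C : ℝ} {k : ℕ} (hb : ∀ x, |h' x| ≤ C * |x| ^ k) (x : ℝ) :
    |h x| ≤ C * |x| ^ (k + 1) := by
  have hC : 0 ≤ C := by simpa using (abs_nonneg _).trans (hb 1)
  have key := (convex_Icc (-|x|) |x|).norm_image_sub_le_of_norm_hasDerivWithin_le
    (f := h) (f' := h') (C := C * |x| ^ k) (x := 0) (y := x)
    (fun y _ => (hd y).hasDerivWithinAt)
    (fun y hy => (hb y).trans (mul_le_mul_of_nonneg_left
      (pow_le_pow_left₀ (abs_nonneg y) (abs_le.2 hy) k) hC))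
    (Set.mem_Icc.2 (by simp)) (Set.mem_Icc.2 (abs_le.1 le_rfl))
  simpa [h0, pow_succ, mul_assoc] using key

/-- Taylor's inequality of order three, without continuity of the third derivative. -/
lemma abs_taylor_two_le {g : ℝ → ℝ} (hg : ∀ k < 3, Differentiable ℝ (iteratedDeriv k g)) {K : ℝ}
    (hK : ∀ x, |iteratedDeriv 3 g x| ≤ K) (u δ : ℝ) :
    |g (u + δ) - g u - iteratedDeriv 1 g u * δ - iteratedDeriv 2 g u / 2 * δ ^ 2| ≤
      K * |δ| ^ 3 := by
  have hd : ∀ k < 3, ∀ x, HasDerivAt (fun y => iteratedDeriv k g (u + y))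
      (iteratedDeriv (k + 1) g (u + x)) x := fun k hk x => by
    have := ((hg k hk) (u + x)).hasDerivAt.comp_const_add u x
    rwa [← iteratedDeriv_succ] at this
  have hd0 : ∀ x, HasDerivAt (fun y => g (u + y)) (iteratedDeriv 1 g (u + x)) x := fun x => by
    simpa using hd 0 (by norm_num) x
  -- Each of the three remainders is an antiderivative of the one before it, so the exponent climbs
  -- from 0 to 3.
  have h2 := abs_le_mul_pow_succ_of_hasDerivAt (k := 0) (C := K)
    (h := fun y => iteratedDeriv 2 g (u + y) - iteratedDeriv 2 g u)
    (fun x => (hd 2 (by norm_num) x).sub_const _) (by simp) (fun x => by simpa using hK (u + x))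
  have h1 := abs_le_mul_pow_succ_of_hasDerivAt
    (h := fun y => iteratedDeriv 1 g (u + y) - iteratedDeriv 1 g u - iteratedDeriv 2 g u * y)
    (fun x => by
      refine (((hd 1 (by norm_num) x).sub_const (iteratedDeriv 1 g u)).sub
        ((hasDerivAt_id x).const_mul (iteratedDeriv 2 g u))).congr_deriv ?_
      simp) (by simp) h2
  exact abs_le_mul_pow_succ_of_hasDerivAt
    (h := fun y => g (u + y) - g u - iteratedDeriv 1 g u * y - iteratedDeriv 2 g u / 2 * y ^ 2)
    (fun x => by
      refine ((((hd0 x).sub_const (g u)).sub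
        ((hasDerivAt_id x).const_mul (iteratedDeriv 1 g u))).sub
        (((hasDerivAt_id x).pow 2).const_mul (iteratedDeriv 2 g u / 2))).congr_deriv ?_
      simp
      ring) (by simp) h1 δ

/-- The bound must hold for all `t`, not just small ones. Squaring a full expansion of `v - u` would
produce powers above `|t| ^ 3`; instead `(v - u) ^ 2 - (t * a) ^ 2 = t ^ 2 * S * ((v - u) + t * a)`,
where `S` is bounded and `v - u` is at most linear in `t`. -/
lemma abs_taylor_two_comp_le {g : ℝ → ℝ} (hg : ∀ k < 3, Differentiable ℝ (iteratedDeriv k g))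
    {K₁ K₂ K₃ : ℝ} (h₁ : ∀ x, |iteratedDeriv 1 g x| ≤ K₁) (h₂ : ∀ x, |iteratedDeriv 2 g x| ≤ K₂)
    (h₃ : ∀ x, |iteratedDeriv 3 g x| ≤ K₃) {u v t a b S R A B C : ℝ}
    (hv : v = u + (t * a + t ^ 2 * S)) (hS : S = b + t * R) (ha : |a| ≤ A) (hSB : |S| ≤ B)
    (hR : |R| ≤ C) (hvA : |v - u| ≤ A * |t|) :
    |g v - g u - iteratedDeriv 1 g u * a * t -
      (iteratedDeriv 1 g u * b + iteratedDeriv 2 g u / 2 * a ^ 2) * t ^ 2| ≤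
      (K₁ * C + K₂ * A * B + K₃ * A ^ 3) * |t| ^ 3 := by
  have hK₁ : 0 ≤ K₁ := (abs_nonneg _).trans (h₁ 0)
  have hK₂ : 0 ≤ K₂ := (abs_nonneg _).trans (h₂ 0)
  have hK₃ : 0 ≤ K₃ := (abs_nonneg _).trans (h₃ 0)
  have hA : 0 ≤ A := (abs_nonneg _).trans ha
  have hB : 0 ≤ B := (abs_nonneg _).trans hSB
  have hT := abs_taylor_two_le hg h₃ u (v - u)
  have hT' : K₃ * |v - u| ^ 3 ≤ K₃ * A ^ 3 * |t| ^ 3 := by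
    rw [mul_assoc, ← mul_pow]
    gcongr
  have e1 : |iteratedDeriv 1 g u * (t ^ 3 * R)| ≤ K₁ * C * |t| ^ 3 := by
    rw [abs_mul, abs_mul, abs_pow, mul_assoc, mul_comm C]
    gcongr
    exact h₁ u
  have e2 : |iteratedDeriv 2 g u / 2 * (t ^ 2 * S * ((v - u) + t * a))| ≤
      K₂ * A * B * |t| ^ 3 := by
    have : |(v - u) + t * a| ≤ 2 * (A * |t|) := by
      refine (abs_add_le _ _).trans ?_
      rw [abs_mul, mul_comm |t|]
      have : |a| * |t| ≤ A * |t| := by gcongr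
      linarith
    rw [abs_mul, abs_mul, abs_mul, abs_div, abs_pow, abs_two]
    calc _ ≤ K₂ / 2 * (|t| ^ 2 * B * (2 * (A * |t|))) := by
          gcongr
          exact h₂ u
      _ = _ := by ring
  have e : g v - g u - iteratedDeriv 1 g u * a * t -
      (iteratedDeriv 1 g u * b + iteratedDeriv 2 g u / 2 * a ^ 2) * t ^ 2 =
      (g (u + (v - u)) - g u - iteratedDeriv 1 g u * (v - u) -
        iteratedDeriv 2 g u / 2 * (v - u) ^ 2) + iteratedDeriv 1 g u * (t ^ 3 * R) +
        iteratedDeriv 2 g u / 2 * (t ^ 2 * S * ((v - u) + t * a)) := by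
    rw [add_sub_cancel]
    have : v - u = t * a + t ^ 2 * S := by rw [hv]; ring
    rw [this]
    have hbS : b = S - t * R := by rw [hS]; ring
    rw [hbS]
    ring
  rw [e]
  refine (abs_add_three _ _ _).trans ?_
  linarith

lemma abs_sub_le_mul_of_abs_iteratedDeriv_one_le {g : ℝ → ℝ} (hg : Differentiable ℝ g) {K : ℝ}
    (hK : ∀ x, |iteratedDeriv 1 g x| ≤ K) (x y : ℝ) : |g y - g x| ≤ K * |y - x| :=
  convex_univ.norm_image_sub_le_of_norm_deriv_le (fun t _ => hg t)
    (fun t _ => by simpa using hK t) (Set.mem_univ x) (Set.mem_univ y)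

/-! ### Resolvents of Hermitian matrices in operator norm. -/

section Resolvent

open scoped Matrix.Norms.L2Operator

variable {n : Type*} [Fintype n] [DecidableEq n]

lemma Matrix.norm_entry_le_l2_opNorm (M : Matrix n n ℂ) (i j : n) : ‖M i j‖ ≤ ‖M‖ := by
  have h := M.l2_opNorm_mulVec (EuclideanSpace.single j 1)
  have h2 := PiLp.norm_apply_le (M.mulVec (EuclideanSpace.single j (1 : ℂ)) |> WithLp.toLp 2) i
  simp at h h2
  exact h2.trans h

/-- By the C*-identity, `E_jjᴴ E_jj = E_jj` gives `‖E_jj‖ ^ 2 = ‖E_jj‖`, and then `E_ijᴴ E_ij =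
E_jj` gives the general case. -/
lemma Matrix.l2_opNorm_single_one_le (i j : n) : ‖(Matrix.single i j (1 : ℂ))‖ ≤ 1 := by
  have h : ∀ i : n, ‖(Matrix.single i i (1 : ℂ))‖ ≤ 1 := fun i => by
    have h1 := Matrix.l2_opNorm_conjTranspose_mul_self (Matrix.single i i (1 : ℂ))
    simp at h1
    by_contra! h2
    nlinarith
  have h1 := Matrix.l2_opNorm_conjTranspose_mul_self (Matrix.single i j (1 : ℂ))
  simp at h1
  have := h j
  by_contra! h2
  nlinarith

variable {A B : Matrix n n ℂ} {z : ℂ}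

lemma Matrix.IsHermitian.isUnit_sub_smul_one (hA : A.IsHermitian) (hz : z.im ≠ 0) :
    IsUnit (A - z • (1 : Matrix n n ℂ)) := by
  have : z ∉ spectrum ℂ A := fun h => hz (by
    have := IsSelfAdjoint.mem_spectrum_eq_re (a := A) hA h
    rw [this]; simp)
  rw [spectrum.notMem_iff] at this
  rw [← IsUnit.neg_iff, neg_sub]
  simpa [Algebra.algebraMap_eq_smul_one] using this

lemma inv_sub_inv_eq_mul (hA : A.IsHermitian) (hB : B.IsHermitian) (hz : z.im ≠ 0) :
    (B - z • 1)⁻¹ = (A - z • 1)⁻¹ - (B - z • 1)⁻¹ * (B - A) * (A - z • 1)⁻¹ := by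
  have h1 := (Matrix.isUnit_iff_isUnit_det _).1 (hA.isUnit_sub_smul_one hz)
  have h2 := (Matrix.isUnit_iff_isUnit_det _).1 (hB.isUnit_sub_smul_one hz)
  have e : B - A = (B - z • 1) - (A - z • 1) := by abel
  rw [e, mul_sub, sub_mul, Matrix.nonsing_inv_mul _ h2, mul_assoc _ (A - z • 1),
    Matrix.mul_nonsing_inv _ h1]
  simp

/-- From `Gᴴ - G = (z̄ - z) Gᴴ G` and the C*-identity, `2 |Im z| ‖G‖ ^ 2 ≤ 2 ‖G‖`. -/
lemma norm_inv_sub_smul_one_le (hA : A.IsHermitian) (hz : z.im ≠ 0) :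
    ‖(A - z • 1)⁻¹‖ ≤ |z.im|⁻¹ := by
  set G := (A - z • (1 : Matrix n n ℂ))⁻¹ with hG
  have h1 := (Matrix.isUnit_iff_isUnit_det _).1 (hA.isUnit_sub_smul_one hz)
  have hstar : G.conjTranspose = (A - (starRingEnd ℂ z) • (1 : Matrix n n ℂ))⁻¹ := by
    rw [hG, Matrix.conjTranspose_nonsing_inv, Matrix.conjTranspose_sub, hA.eq]
    simp
  have hz' : (starRingEnd ℂ z).im ≠ 0 := by simpa using hz
  have h2 := (Matrix.isUnit_iff_isUnit_det _).1 (hA.isUnit_sub_smul_one hz')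
  have key : G.conjTranspose - G = (starRingEnd ℂ z - z) • (G.conjTranspose * G) := by
    have e : (starRingEnd ℂ z - z) • (1 : Matrix n n ℂ) =
      (A - z • 1) - (A - (starRingEnd ℂ z) • 1) := by rw [sub_smul]; abel
    have : (starRingEnd ℂ z - z) • (G.conjTranspose * G) =
        G.conjTranspose * ((starRingEnd ℂ z - z) • 1) * G := by simp
    rw [this, e, mul_sub, sub_mul, hstar, Matrix.nonsing_inv_mul _ h2, mul_assoc _ (A - z • 1), hG,
      Matrix.mul_nonsing_inv _ h1]
    simp
  have hn := congrArg norm key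
  rw [norm_smul, Matrix.l2_opNorm_conjTranspose_mul_self] at hn
  have hzz : ‖starRingEnd ℂ z - z‖ = 2 * |z.im| := by
    rw [← norm_neg, neg_sub, Complex.sub_conj]
    simp
  have hle := norm_sub_le G.conjTranspose G
  rw [hn, hzz, Matrix.l2_opNorm_conjTranspose] at hle
  have hpos : 0 < |z.im| := abs_pos.2 hz
  rw [inv_eq_one_div, le_div_iff₀ hpos]
  by_contra! h
  have : 0 < ‖G‖ := by
    by_contra! h0
    nlinarith [norm_nonneg G]
  nlinarith

end Resolvent

/-! ### The symmetric matrix as a function of its entries. -/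

section WignerMatrix

open scoped Matrix.Norms.L2Operator

variable {N : ℕ} {z : ℂ}

lemma upperIndex_comm (i j : Fin N) : upperIndex i j = upperIndex j i := by
  unfold upperIndex
  split_ifs with h1 h2 h2
  · have : i = j := le_antisymm h1 h2
    subst this; rfl
  · rfl
  · rfl
  · omega

lemma isHermitian_wignerMatrix (x : UpperPair N → ℝ) : (wignerMatrix x).IsHermitian := by
  ext i j
  simp [wignerMatrix, upperIndex_comm i j]

lemma wignerMatrix_add (x y : UpperPair N → ℝ) :
    wignerMatrix (x + y) = wignerMatrix x + wignerMatrix y := by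
  ext i j
  simp [wignerMatrix, mul_add]

lemma wignerMatrix_smul (t : ℝ) (x : UpperPair N → ℝ) :
    wignerMatrix (t • x) = (t : ℂ) • wignerMatrix x := by
  ext i j
  simp [wignerMatrix, mul_left_comm]

lemma wignerMatrix_sub_update_zero (x : UpperPair N → ℝ) (p : UpperPair N) :
    wignerMatrix x - wignerMatrix (Function.update x p 0) =
      (x p : ℂ) • wignerMatrix (Pi.single p 1) := by
  rw [sub_eq_iff_eq_add, ← wignerMatrix_smul, ← wignerMatrix_add]
  congr 1
  ext q
  by_cases h : q = p
  · subst h; simp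
  · simp [h]

lemma upperIndex_eq_iff (a b : Fin N) (p : UpperPair N) :
    upperIndex a b = p ↔ (p.1.1 = a ∧ p.1.2 = b) ∨ (p.1.2 = a ∧ p.1.1 = b) := by
  obtain ⟨⟨i, j⟩, hij⟩ := p
  have hij' : i ≤ j := hij
  unfold upperIndex
  split_ifs with h <;> simp only [Subtype.mk.injEq, Prod.mk.injEq] <;> omega

lemma wignerMatrix_single (p : UpperPair N) : ∃ c : ℂ, ‖c‖ ≤ (N : ℝ) ^ (-1 / 2 : ℝ) ∧
    wignerMatrix (Pi.single p 1) =
      (((N : ℝ) ^ (-1 / 2 : ℝ) : ℝ) : ℂ) • Matrix.single p.1.1 p.1.2 (1 : ℂ) +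
        c • Matrix.single p.1.2 p.1.1 (1 : ℂ) := by
  have hs : 0 ≤ (N : ℝ) ^ (-1 / 2 : ℝ) := by positivity
  obtain ⟨⟨i, j⟩, hij⟩ := p
  have hij' : i ≤ j := hij
  -- On the diagonal the two matrix units coincide and must be counted once.
  refine ⟨if i = j then 0 else (((N : ℝ) ^ (-1 / 2 : ℝ) : ℝ) : ℂ), ?_, ?_⟩
  · split_ifs
    · simpa using hs
    · rw [Complex.norm_real, Real.norm_of_nonneg hs]
  · ext a b
    have hiff := upperIndex_eq_iff a b ⟨(i, j), hij⟩
    simp only [wignerMatrix, Matrix.of_apply, Matrix.add_apply, Matrix.smul_apply, smul_eq_mul,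
      Matrix.single_apply, Pi.single_apply, hiff]
    clear hiff
    by_cases h : i = j
    · subst h
      by_cases h1 : i = a ∧ i = b
      · obtain ⟨rfl, rfl⟩ := h1
        simp
      · simp [h1]
    · by_cases h1 : i = a ∧ j = b
      · obtain ⟨rfl, rfl⟩ := h1
        simp [h, Ne.symm h]
      · by_cases h2 : j = a ∧ i = b
        · obtain ⟨rfl, rfl⟩ := h2
          simp [h]
        · simp [h1, h2]

lemma norm_wignerMatrix_single_le (p : UpperPair N) :
    ‖wignerMatrix (Pi.single p 1)‖ ≤ 2 * (N : ℝ) ^ (-1 / 2 : ℝ) := by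
  have hs : 0 ≤ (N : ℝ) ^ (-1 / 2 : ℝ) := by positivity
  obtain ⟨c, hc, h⟩ := wignerMatrix_single p
  rw [h, two_mul]
  refine (norm_add_le _ _).trans (add_le_add ?_ ?_)
  · rw [norm_smul, Complex.norm_real, Real.norm_of_nonneg hs]
    exact mul_le_of_le_one_right hs (Matrix.l2_opNorm_single_one_le _ _)
  · rw [norm_smul]
    exact (mul_le_of_le_one_right (norm_nonneg _) (Matrix.l2_opNorm_single_one_le _ _)).trans hc

/-- The trace picks out at most two entries of `M`, so no factor `N` appears, unlike in
`norm_trace_le`. -/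
lemma norm_trace_wignerMatrix_single_mul_le (p : UpperPair N) (M : Matrix (Fin N) (Fin N) ℂ) :
    ‖(wignerMatrix (Pi.single p 1) * M).trace‖ ≤ 2 * (N : ℝ) ^ (-1 / 2 : ℝ) * ‖M‖ := by
  have hs : 0 ≤ (N : ℝ) ^ (-1 / 2 : ℝ) := by positivity
  obtain ⟨c, hc, h⟩ := wignerMatrix_single p
  rw [h, add_mul, Matrix.trace_add, smul_mul_assoc, smul_mul_assoc, Matrix.trace_smul,
    Matrix.trace_smul, Matrix.trace_single_mul, Matrix.trace_single_mul, two_mul, add_mul]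
  refine (norm_add_le _ _).trans (add_le_add ?_ ?_)
  · rw [norm_smul, Complex.norm_real, Real.norm_of_nonneg hs, one_smul]
    exact mul_le_mul_of_nonneg_left (M.norm_entry_le_l2_opNorm _ _) hs
  · rw [norm_smul, one_smul]
    exact mul_le_mul hc (M.norm_entry_le_l2_opNorm _ _) (norm_nonneg _) hs

/-- The resolvent of the matrix `wignerMatrix x` at `z`. -/
noncomputable def wignerResolvent (z : ℂ) (x : UpperPair N → ℝ) : Matrix (Fin N) (Fin N) ℂ :=
  (wignerMatrix x - z • 1)⁻¹

lemma norm_wignerResolvent_le (hz : z.im ≠ 0) (x : UpperPair N → ℝ) :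
    ‖wignerResolvent z x‖ ≤ |z.im|⁻¹ :=
  norm_inv_sub_smul_one_le (isHermitian_wignerMatrix x) hz

lemma wignerResolvent_eq_sub (hz : z.im ≠ 0) (x y : UpperPair N → ℝ) :
    wignerResolvent z y = wignerResolvent z x -
      wignerResolvent z y * (wignerMatrix y - wignerMatrix x) * wignerResolvent z x :=
  inv_sub_inv_eq_mul (isHermitian_wignerMatrix x) (isHermitian_wignerMatrix y) hz

lemma continuous_wignerMatrix : Continuous (wignerMatrix (N := N)) := by
  refine continuous_matrix fun i j => ?_
  simp only [wignerMatrix, Matrix.of_apply]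
  fun_prop

lemma continuous_wignerResolvent (hz : z.im ≠ 0) :
    Continuous (wignerResolvent (N := N) z) := by
  have hc : Continuous fun x : UpperPair N → ℝ =>
      wignerMatrix x - z • (1 : Matrix (Fin N) (Fin N) ℂ) :=
    continuous_wignerMatrix.sub continuous_const
  have h : wignerResolvent (N := N) z = fun x =>
      (wignerMatrix x - z • (1 : Matrix (Fin N) (Fin N) ℂ)).det⁻¹ •
        -- Cramer's rule: the inverse is a quotient of polynomials in the entries, with a
        -- determinant that never vanishes.
        (wignerMatrix x - z • (1 : Matrix (Fin N) (Fin N) ℂ)).adjugate := by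
    ext1 x
    rw [wignerResolvent, Matrix.inv_def, Ring.inverse_eq_inv']
  rw [h]
  refine (hc.matrix_det.inv₀ fun x => ?_).smul hc.matrix_adjugate
  exact ((Matrix.isUnit_iff_isUnit_det _).1
    ((isHermitian_wignerMatrix x).isUnit_sub_smul_one hz)).ne_zero

lemma continuous_stieltjes_wignerMatrix (hz : z.im ≠ 0) :
    Continuous fun x : UpperPair N → ℝ => stieltjes (wignerMatrix x) z :=
  continuous_const.mul (continuous_wignerResolvent hz).matrix_trace

lemma norm_trace_le (M : Matrix (Fin N) (Fin N) ℂ) : ‖M.trace‖ ≤ N * ‖M‖ := by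
  refine (norm_sum_le _ _).trans ((Finset.sum_le_sum fun i _ =>
    M.norm_entry_le_l2_opNorm i i).trans_eq ?_)
  simp

lemma norm_stieltjes_wignerMatrix_le (hN : 0 < N) (hz : z.im ≠ 0) (x : UpperPair N → ℝ) :
    ‖stieltjes (wignerMatrix x) z‖ ≤ |z.im|⁻¹ := by
  have hN' : (0 : ℝ) < N := by exact_mod_cast hN
  rw [stieltjes, norm_mul, norm_inv, Complex.norm_natCast, inv_mul_le_iff₀ hN']
  exact (norm_trace_le _).trans
    (mul_le_mul_of_nonneg_left (norm_wignerResolvent_le hz x) hN'.le)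

/-- Changing all entries by the same amount. -/
lemma norm_stieltjes_centred_sub_le (hN : 0 < N) (hz : z.im ≠ 0) (x : UpperPair N → ℝ) :
    ‖stieltjes (wignerMatrix (centred x)) z - stieltjes (wignerMatrix x) z‖ ≤
      N * (N : ℝ) ^ (-1 / 2 : ℝ) * |z.im|⁻¹ ^ 2 * |upperMean x| := by
  have hN' : (0 : ℝ) < N := by exact_mod_cast hN
  set s : ℝ := (N : ℝ) ^ (-1 / 2 : ℝ) with hs
  have hs0 : 0 ≤ s := by positivity
  set M := wignerResolvent z x * wignerResolvent z (centred x) with hM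
  have hMn : ‖M‖ ≤ |z.im|⁻¹ ^ 2 := by
    rw [sq]
    exact (norm_mul_le _ _).trans (mul_le_mul (norm_wignerResolvent_le hz _)
      (norm_wignerResolvent_le hz _) (norm_nonneg _) (by positivity))
  have hd : wignerMatrix (centred x) - wignerMatrix x =
      Matrix.of fun _ _ => ((-(s * upperMean x) : ℝ) : ℂ) := by
    ext i j
    simp [wignerMatrix, centred, hs]
    ring
  have e : stieltjes (wignerMatrix (centred x)) z - stieltjes (wignerMatrix x) z =
      -((N : ℂ)⁻¹ * ((wignerMatrix (centred x) - wignerMatrix x) * M).trace) := by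
    have h := wignerResolvent_eq_sub hz x (centred x)
    simp only [stieltjes]
    change (N : ℂ)⁻¹ * (wignerResolvent z (centred x)).trace -
      (N : ℂ)⁻¹ * (wignerResolvent z x).trace = _
    nth_rw 1 [h]
    rw [Matrix.trace_sub, Matrix.trace_mul_comm (_ * _), ← mul_assoc, Matrix.trace_mul_comm]
    ring
  -- All `N ^ 2` entries change. After normalisation a factor `N` survives, which the mean, of order
  -- `1 / N` for Gaussians, will offset.
  have htr : ‖((wignerMatrix (centred x) - wignerMatrix x) * M).trace‖ ≤
      N * (N * (s * |upperMean x| * |z.im|⁻¹ ^ 2)) := by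
    rw [hd, Matrix.trace]
    refine (norm_sum_le _ _).trans ?_
    have : ∀ i ∈ (Finset.univ : Finset (Fin N)),
        ‖(Matrix.of (fun _ _ => ((-(s * upperMean x) : ℝ) : ℂ)) * M).diag i‖ ≤
        N * (s * |upperMean x| * |z.im|⁻¹ ^ 2) := fun i _ => by
      rw [Matrix.diag_apply, Matrix.mul_apply]
      refine (norm_sum_le _ _).trans ((Finset.sum_le_sum (g := fun _ =>
        s * |upperMean x| * |z.im|⁻¹ ^ 2) fun j _ => ?_).trans_eq (by simp))
      rw [norm_mul, Matrix.of_apply, Complex.norm_real, norm_neg, norm_mul, Real.norm_of_nonneg hs0,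
        Real.norm_eq_abs]
      exact mul_le_mul_of_nonneg_left ((M.norm_entry_le_l2_opNorm _ _).trans hMn) (by positivity)
    refine (Finset.sum_le_sum this).trans_eq ?_
    simp
  rw [e, norm_neg, norm_mul, norm_inv, Complex.norm_natCast, inv_mul_le_iff₀ hN']
  refine htr.trans_eq ?_
  ring

end WignerMatrix

/-! ### Expansion of the Stieltjes transform in one entry. -/

section Expansion

open scoped Matrix.Norms.L2Operator

variable {N : ℕ} {z : ℂ}

/-- The first derivative of the Stieltjes transform in the entry `p`, where this entry vanishes. -/
noncomputable def stieltjesCoeffOne (z : ℂ) (p : UpperPair N) (x : UpperPair N → ℝ) : ℂ :=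
  -((N : ℂ)⁻¹ * (wignerMatrix (Pi.single p 1) *
    (wignerResolvent z (Function.update x p 0) * wignerResolvent z (Function.update x p 0))).trace)

/-- Half the second derivative of the Stieltjes transform in the entry `p`, where this entry
vanishes. -/
noncomputable def stieltjesCoeffTwo (z : ℂ) (p : UpperPair N) (x : UpperPair N → ℝ) : ℂ :=
  (N : ℂ)⁻¹ * (wignerMatrix (Pi.single p 1) *
    (wignerResolvent z (Function.update x p 0) * wignerMatrix (Pi.single p 1) *
      wignerResolvent z (Function.update x p 0) * wignerResolvent z (Function.update x p 0))).trace

lemma continuous_stieltjesCoeffOne (hz : z.im ≠ 0) (p : UpperPair N) :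
    Continuous (stieltjesCoeffOne z p) := by
  have h := (continuous_wignerResolvent (N := N) hz).comp
    (continuous_id.update p (continuous_const (y := (0 : ℝ))))
  exact (continuous_const.mul (continuous_const.mul (h.mul h)).matrix_trace).neg

lemma continuous_stieltjesCoeffTwo (hz : z.im ≠ 0) (p : UpperPair N) :
    Continuous (stieltjesCoeffTwo z p) := by
  have h := (continuous_wignerResolvent (N := N) hz).comp
    (continuous_id.update p (continuous_const (y := (0 : ℝ))))
  exact continuous_const.mul
    (continuous_const.mul (((h.mul continuous_const).mul h).mul h)).matrix_trace

lemma norm_inv_mul_trace_wignerMatrix_single_mul_le (p : UpperPair N)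
    {M : Matrix (Fin N) (Fin N) ℂ} {κ : ℝ} (hM : ‖M‖ ≤ κ) :
    ‖(N : ℂ)⁻¹ * (wignerMatrix (Pi.single p 1) * M).trace‖ ≤
      2 * (N : ℝ) ^ (-1 / 2 : ℝ) * (N : ℝ)⁻¹ * κ := by
  rw [norm_mul, norm_inv, Complex.norm_natCast]
  calc _ ≤ (N : ℝ)⁻¹ * (2 * (N : ℝ) ^ (-1 / 2 : ℝ) * κ) := by
        gcongr
        exact (norm_trace_wignerMatrix_single_mul_le p M).trans (by gcongr)
    _ = _ := by ring

lemma stieltjes_sub_update_zero (hz : z.im ≠ 0) (p : UpperPair N) (x : UpperPair N → ℝ) :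
    stieltjes (wignerMatrix x) z - stieltjes (wignerMatrix (Function.update x p 0)) z =
      x p * -((N : ℂ)⁻¹ * (wignerMatrix (Pi.single p 1) *
        (wignerResolvent z (Function.update x p 0) * wignerResolvent z x)).trace) := by
  have h := wignerResolvent_eq_sub hz (Function.update x p 0) x
  rw [wignerMatrix_sub_update_zero] at h
  change (N : ℂ)⁻¹ * (wignerResolvent z x).trace -
    (N : ℂ)⁻¹ * (wignerResolvent z (Function.update x p 0)).trace = _
  nth_rw 1 [h]
  rw [Matrix.trace_sub, mul_assoc, Matrix.trace_mul_comm, smul_mul_assoc, smul_mul_assoc,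
    Matrix.trace_smul, mul_assoc, smul_eq_mul]
  ring

/-- The third order expansion of the Stieltjes transform in one entry. -/
lemma exists_stieltjes_expansion (hz : z.im ≠ 0) (p : UpperPair N) (x : UpperPair N → ℝ) :
    ∃ S R : ℂ, stieltjes (wignerMatrix x) z =
        stieltjes (wignerMatrix (Function.update x p 0)) z +
          (x p * stieltjesCoeffOne z p x + x p ^ 2 * S) ∧
      S = stieltjesCoeffTwo z p x + x p * R ∧
      ‖S‖ ≤ 4 * ((N : ℝ) ^ (-1 / 2 : ℝ)) ^ 2 * (N : ℝ)⁻¹ * |z.im|⁻¹ ^ 3 ∧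
      ‖R‖ ≤ 8 * ((N : ℝ) ^ (-1 / 2 : ℝ)) ^ 3 * (N : ℝ)⁻¹ * |z.im|⁻¹ ^ 4 := by
  have hG := norm_wignerResolvent_le hz x
  have hG0 := norm_wignerResolvent_le hz (Function.update x p 0)
  have hE := norm_wignerMatrix_single_le p
  have h := wignerResolvent_eq_sub hz (Function.update x p 0) x
  have h0 := stieltjes_sub_update_zero hz p x
  rw [wignerMatrix_sub_update_zero] at h
  unfold stieltjesCoeffOne stieltjesCoeffTwo
  set G := wignerResolvent z x
  set G₀ := wignerResolvent z (Function.update x p 0)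
  set E := wignerMatrix (Pi.single p 1)
  have h' : G = G₀ - (x p : ℂ) • (G * E * G₀) := by
    nth_rw 1 [h]
    simp
  have h'' : G = G₀ - (x p : ℂ) • (G₀ * E * G) := by
    have := wignerResolvent_eq_sub hz x (Function.update x p 0)
    rw [← neg_sub (wignerMatrix x), wignerMatrix_sub_update_zero] at this
    change G₀ = G - G₀ * -((x p : ℂ) • E) * G at this
    rw [eq_sub_iff_add_eq]
    nth_rw 2 [this]
    simp
  -- `S` is the second coefficient with its last `G₀` replaced by the full resolvent `G`. The
  -- expansion is thus exact, and `S` and `R` are bounded whatever the size of `x p`.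
  refine ⟨(N : ℂ)⁻¹ * (E * (G₀ * E * G₀ * G)).trace,
    -((N : ℂ)⁻¹ * (E * (G₀ * E * G₀ * (G₀ * E * G))).trace), ?_, ?_, ?_, ?_⟩
  · rw [← sub_eq_iff_eq_add', h0]
    have e : (E * (G₀ * G)).trace =
        (E * (G₀ * G₀)).trace - (x p : ℂ) * (E * (G₀ * E * G₀ * G)).trace := by
      have e1 : E * (G₀ * G) = E * (G₀ * G₀) - (x p : ℂ) • (E * G₀ * G * (E * G₀)) := by
        nth_rw 1 [h']
        simp [mul_sub, mul_assoc]
      rw [e1, Matrix.trace_sub, Matrix.trace_smul, smul_eq_mul,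
        Matrix.trace_mul_comm (E * G₀ * G)]
      simp only [mul_assoc]
    rw [e]
    ring
  · have e : E * (G₀ * E * G₀ * G) =
        E * (G₀ * E * G₀ * G₀) - (x p : ℂ) • (E * (G₀ * E * G₀ * (G₀ * E * G))) := by
      nth_rw 1 [h'']
      simp [mul_sub]
    rw [e, Matrix.trace_sub, Matrix.trace_smul, smul_eq_mul]
    ring
  · refine (norm_inv_mul_trace_wignerMatrix_single_mul_le p (norm_mul_le_of_le (norm_mul_le_of_le
      (norm_mul_le_of_le hG0 hE) hG0) hG)).trans_eq ?_
    ring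
  · rw [norm_neg]
    refine (norm_inv_mul_trace_wignerMatrix_single_mul_le p (norm_mul_le_of_le (norm_mul_le_of_le
      (norm_mul_le_of_le hG0 hE) hG0) 
      (norm_mul_le_of_le (norm_mul_le_of_le hG0 hE) hG))).trans_eq ?_
    ring

lemma norm_stieltjesCoeffOne_le (hz : z.im ≠ 0) (p : UpperPair N) (x : UpperPair N → ℝ) :
    ‖stieltjesCoeffOne z p x‖ ≤ 2 * (N : ℝ) ^ (-1 / 2 : ℝ) * (N : ℝ)⁻¹ * |z.im|⁻¹ ^ 2 := by
  have hG0 := norm_wignerResolvent_le hz (Function.update x p 0)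
  rw [stieltjesCoeffOne, norm_neg, sq]
  exact norm_inv_mul_trace_wignerMatrix_single_mul_le p (norm_mul_le_of_le hG0 hG0)

lemma norm_stieltjesCoeffTwo_le (hz : z.im ≠ 0) (p : UpperPair N) (x : UpperPair N → ℝ) :
    ‖stieltjesCoeffTwo z p x‖ ≤
      4 * ((N : ℝ) ^ (-1 / 2 : ℝ)) ^ 2 * (N : ℝ)⁻¹ * |z.im|⁻¹ ^ 3 := by
  have hG0 := norm_wignerResolvent_le hz (Function.update x p 0)
  have hE := norm_wignerMatrix_single_le p
  refine (norm_inv_mul_trace_wignerMatrix_single_mul_le p (norm_mul_le_of_le (norm_mul_le_of_le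
    (norm_mul_le_of_le hG0 hE) hG0) hG0)).trans_eq ?_
  ring

lemma norm_stieltjes_sub_update_zero_le (hz : z.im ≠ 0) (p : UpperPair N)
    (x : UpperPair N → ℝ) :
    ‖stieltjes (wignerMatrix x) z - stieltjes (wignerMatrix (Function.update x p 0)) z‖ ≤
      2 * (N : ℝ) ^ (-1 / 2 : ℝ) * (N : ℝ)⁻¹ * |z.im|⁻¹ ^ 2 * |x p| := by
  rw [stieltjes_sub_update_zero hz, norm_mul, norm_neg, Complex.norm_real, Real.norm_eq_abs,
    mul_comm, sq]
  gcongr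
  exact norm_inv_mul_trace_wignerMatrix_single_mul_le p
    (norm_mul_le_of_le (norm_wignerResolvent_le hz _) (norm_wignerResolvent_le hz _))

/-- A smooth function of a real-linear functional of the Stieltjes transform, such as its real or
imaginary part, has small coordinate expansions. -/
lemma hasCoordinateExpansion_comp_stieltjes (hN : 0 < N) (hz : z.im ≠ 0) {g : ℝ → ℝ}
    (hg : ∀ k < 3, Differentiable ℝ (iteratedDeriv k g)) {K₁ K₂ K₃ : ℝ}
    (h₁ : ∀ x, |iteratedDeriv 1 g x| ≤ K₁) (h₂ : ∀ x, |iteratedDeriv 2 g x| ≤ K₂)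
    (h₃ : ∀ x, |iteratedDeriv 3 g x| ≤ K₃) {ℓ : ℂ →L[ℝ] ℝ} (hℓ : ∀ w, |ℓ w| ≤ ‖w‖)
    {s κ : ℝ} (hs : s = (N : ℝ) ^ (-1 / 2 : ℝ)) (hκ : κ = |z.im|⁻¹) :
    ∃ a b, HasCoordinateExpansion
      (fun x : UpperPair N → ℝ => g (ℓ (stieltjes (wignerMatrix x) z))) a b
      (2 * K₁ * κ ^ 2 * s ^ 3) ((4 * K₁ * κ ^ 3 + 2 * K₂ * κ ^ 4) * s ^ 4)
      ((8 * K₁ * κ ^ 4 + 8 * K₂ * κ ^ 5 + 8 * K₃ * κ ^ 6) * s ^ 5) := by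
  have hK₁ : 0 ≤ K₁ := (abs_nonneg _).trans (h₁ 0)
  have hK₂ : 0 ≤ K₂ := (abs_nonneg _).trans (h₂ 0)
  have hK₃ : 0 ≤ K₃ := (abs_nonneg _).trans (h₃ 0)
  have hκ0 : 0 ≤ κ := by rw [hκ]; positivity
  have hs0 : 0 ≤ s := by rw [hs]; positivity
  have hN1 : (1 : ℝ) ≤ N := by exact_mod_cast hN
  have hs1 : s ≤ 1 := by
    rw [hs]; exact Real.rpow_le_one_of_one_le_of_nonpos hN1 (by norm_num)
  have hs2 : (N : ℝ)⁻¹ = s ^ 2 := by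
    rw [hs, ← Real.rpow_natCast, ← Real.rpow_mul (by positivity), ← Real.rpow_neg_one]
    norm_num
  have hm1 : ∀ (p : UpperPair N) x, |ℓ (stieltjesCoeffOne z p x)| ≤ 2 * κ ^ 2 * s ^ 3 := fun p x => by
    refine ((hℓ _).trans (norm_stieltjesCoeffOne_le hz p x)).trans_eq ?_
    rw [← hs, ← hκ, hs2]; ring
  have hm2 : ∀ (p : UpperPair N) x, |ℓ (stieltjesCoeffTwo z p x)| ≤ 4 * κ ^ 3 * s ^ 4 := fun p x => by
    refine ((hℓ _).trans (norm_stieltjesCoeffTwo_le hz p x)).trans_eq ?_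
    rw [← hs, ← hκ, hs2]; ring
  set u : UpperPair N → (UpperPair N → ℝ) → ℝ :=
    fun p x => ℓ (stieltjes (wignerMatrix (Function.update x p 0)) z) with hu
  have hum : ∀ p, Measurable (u p) := fun p =>
    (ℓ.continuous.comp ((continuous_stieltjes_wignerMatrix hz).comp
      (continuous_id.update p (continuous_const (y := (0 : ℝ)))))).measurable
  have hm1m : ∀ p : UpperPair N, Measurable fun x => ℓ (stieltjesCoeffOne z p x) := fun p =>
    (ℓ.continuous.comp (continuous_stieltjesCoeffOne hz p)).measurable
  have hm2m : ∀ p : UpperPair N, Measurable fun x => ℓ (stieltjesCoeffTwo z p x) := fun p =>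
    (ℓ.continuous.comp (continuous_stieltjesCoeffTwo hz p)).measurable
  have hg1 := (hg 1 (by norm_num)).continuous.measurable
  have hg2 := (hg 2 (by norm_num)).continuous.measurable
  -- Chain rule at the point where the entry vanishes: `g' m'` and `g' m'' / 2 + g'' (m') ^ 2 / 2`.
  refine ⟨fun p x => iteratedDeriv 1 g (u p x) * ℓ (stieltjesCoeffOne z p x),
    fun p x => iteratedDeriv 1 g (u p x) * ℓ (stieltjesCoeffTwo z p x) +
      iteratedDeriv 2 g (u p x) / 2 * ℓ (stieltjesCoeffOne z p x) ^ 2,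
    fun p => (hg1.comp (hum p)).mul (hm1m p),
    fun p => ((hg1.comp (hum p)).mul (hm2m p)).add
      (((hg2.comp (hum p)).div_const 2).mul ((hm1m p).pow_const 2)),
    fun p x t => by simp [hu, stieltjesCoeffOne],
    fun p x t => by simp [hu, stieltjesCoeffOne, stieltjesCoeffTwo], fun p x => ?_, fun p x => ?_,
    fun p x => ?_⟩
  · rw [abs_mul]
    calc _ ≤ K₁ * (2 * κ ^ 2 * s ^ 3) := by
          gcongr
          exacts [h₁ _, hm1 p x]
      _ = _ := by ring
  · refine (abs_add_le _ _).trans ?_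
    rw [abs_mul, abs_mul, abs_div, abs_pow, abs_two]
    calc _ ≤ K₁ * (4 * κ ^ 3 * s ^ 4) + K₂ / 2 * (2 * κ ^ 2 * s ^ 3) ^ 2 := by
          gcongr
          exacts [h₁ _, hm2 p x, h₂ _, hm1 p x]
      -- The square of the first coefficient is of order `s ^ 6`, smaller than needed; `s ≤ 1`
      -- reduces it to `s ^ 4`.
      _ = 4 * K₁ * κ ^ 3 * s ^ 4 + 2 * K₂ * κ ^ 4 * (s ^ 4 * s ^ 2) := by ring
      _ ≤ 4 * K₁ * κ ^ 3 * s ^ 4 + 2 * K₂ * κ ^ 4 * (s ^ 4 * 1) := by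
          gcongr
          exact pow_le_one₀ hs0 hs1
      _ = _ := by ring
  · obtain ⟨S, R, e1, e2, hS, hR⟩ := exists_stieltjes_expansion hz p x
    have hℓr : ∀ (r : ℝ) (w : ℂ), ℓ (r * w) = r * ℓ w := fun r w => by
      rw [← Complex.real_smul, map_smul, smul_eq_mul]
    have e1' : ℓ (stieltjes (wignerMatrix x) z) =
        u p x + (x p * ℓ (stieltjesCoeffOne z p x) + x p ^ 2 * ℓ S) := by
      rw [e1, map_add, map_add, hℓr, ← Complex.ofReal_pow, hℓr]
    have e2' : ℓ S = ℓ (stieltjesCoeffTwo z p x) + x p * ℓ R := by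
      rw [e2, map_add, hℓr]
    have hS' : |ℓ S| ≤ 4 * κ ^ 3 * s ^ 4 := by
      refine ((hℓ _).trans hS).trans_eq ?_
      rw [← hs, ← hκ, hs2]; ring
    have hR' : |ℓ R| ≤ 8 * κ ^ 4 * s ^ 5 := by
      refine ((hℓ _).trans hR).trans_eq ?_
      rw [← hs, ← hκ, hs2]; ring
    have hd : |ℓ (stieltjes (wignerMatrix x) z) - u p x| ≤ 2 * κ ^ 2 * s ^ 3 * |x p| := by
      rw [hu, ← map_sub]
      refine ((hℓ _).trans (norm_stieltjes_sub_update_zero_le hz p x)).trans_eq ?_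
      rw [← hs, ← hκ, hs2]; ring
    refine (abs_taylor_two_comp_le hg h₁ h₂ h₃ e1' e2' (hm1 p x) hS' hR' hd).trans ?_
    gcongr
    calc _ = 8 * K₁ * κ ^ 4 * s ^ 5 + 8 * K₂ * κ ^ 5 * (s ^ 5 * s ^ 2) +
          8 * K₃ * κ ^ 6 * (s ^ 5 * s ^ 4) := by ring
      _ ≤ 8 * K₁ * κ ^ 4 * s ^ 5 + 8 * K₂ * κ ^ 5 * (s ^ 5 * 1) +
          8 * K₃ * κ ^ 6 * (s ^ 5 * 1) := by
          gcongr <;> exact pow_le_one₀ hs0 hs1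
      _ = _ := by ring

end Expansion

/-! ### Size of the Gaussian mean and assembly of the bound. -/

section Comparison

variable {N : ℕ}

lemma two_mul_card_upperPair (N : ℕ) : 2 * (Fintype.card (UpperPair N) : ℝ) = N * (N + 1) := by
  have h : Fintype.card (UpperPair N) = ∑ j ∈ Finset.range N, (j + 1) := by
    rw [Fintype.card_subtype, Finset.card_filter, Fintype.sum_prod_type_right, Finset.sum_range]
    refine Finset.sum_congr rfl fun j _ => ?_
    rw [← Finset.card_filter, Finset.filter_ge_eq_Iic, Fin.card_Iic]
  rw [h]
  push_cast
  clear h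
  induction N with
  | zero => simp
  | succ N ih =>
    rw [Finset.sum_range_succ, mul_add, ih]
    push_cast
    ring

lemma upperMean_eq_inv_card_mul (x : UpperPair N → ℝ) :
    upperMean x = (Fintype.card (UpperPair N) : ℝ)⁻¹ * ∑ p, x p := by
  rw [upperMean, ← two_mul_card_upperPair, div_mul_eq_div_div, div_self two_ne_zero, one_div]

lemma card_upperPair_pos (hN : 0 < N) : (0 : ℝ) < Fintype.card (UpperPair N) := by
  have h := two_mul_card_upperPair N
  have : (0 : ℝ) < N := by exact_mod_cast hN
  nlinarith

lemma memLp_id_gaussianReal_three : MemLp id 3 (gaussianReal 0 1) :=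
  memLp_id_gaussianReal' 3 (by norm_num)

lemma integral_sq_gaussianReal_zero_one : ∫ t, t ^ 2 ∂gaussianReal 0 1 = 1 := by
  have h := variance_fun_id_gaussianReal (μ := 0) (v := 1)
  rw [variance_of_integral_eq_zero (by fun_prop) integral_id_gaussianReal] at h
  simpa using h

/-- By independence the sum has variance `n`, so `E |mean| ≤ n ^ (-1/2)`, and `n` is at least `N ^ 2
/ 2`. -/
lemma integral_abs_upperMean_pi_gaussianReal_le (hN : 0 < N) :
    Integrable (fun x : UpperPair N → ℝ => upperMean x)
      (Measure.pi fun _ => gaussianReal 0 1) ∧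
    ∫ x : UpperPair N → ℝ, |upperMean x| ∂Measure.pi (fun _ => gaussianReal 0 1) ≤
      2 * (N : ℝ)⁻¹ := by
  set ν := Measure.pi fun _ : UpperPair N => gaussianReal 0 1 with hν
  set n : ℝ := (Fintype.card (UpperPair N) : ℝ) with hn
  have hn0 : 0 < n := card_upperPair_pos hN
  have hN0 : (0 : ℝ) < N := by exact_mod_cast hN
  have hlp : ∀ p, MemLp (fun x : UpperPair N → ℝ => x p) 2 ν := fun p =>
    (memLp_id_gaussianReal' 2 (by norm_num)).comp_measurePreserving
      (measurePreserving_eval (fun _ : UpperPair N => gaussianReal 0 1) p)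
  have hmean : ∀ p, ∫ x : UpperPair N → ℝ, x p ∂ν = 0 := fun p => by
    rw [hν, integral_comp_eval (μ := fun _ : UpperPair N => gaussianReal 0 1) (f := fun t => t)
      (by fun_prop), integral_id_gaussianReal]
  have hind : iIndepFun (fun (p : UpperPair N) (x : UpperPair N → ℝ) => x p) ν :=
    iIndepFun_pi (X := fun _ t => t) (fun _ => aemeasurable_id)
  have hvar : Var[∑ p, fun x : UpperPair N → ℝ => x p; ν] = n := by
    rw [IndepFun.variance_sum (fun p _ => hlp p) (fun p _ q _ hpq => hind.indepFun hpq)]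
    have : ∀ p ∈ (Finset.univ : Finset (UpperPair N)),
        Var[fun x : UpperPair N → ℝ => x p; ν] = 1 := fun p _ => by
      rw [variance_of_integral_eq_zero (measurable_pi_apply p).aemeasurable (hmean p), hν,
        integral_comp_eval (μ := fun _ : UpperPair N => gaussianReal 0 1) (f := fun t => t ^ 2)
        (by fun_prop), integral_sq_gaussianReal_zero_one]
    rw [Finset.sum_congr rfl this]
    simp [hn]
  have hS : MemLp (fun x : UpperPair N → ℝ => ∑ p, x p) 2 ν :=
    memLp_finsetSum _ fun p _ => hlp p
  have hS2 : ∫ x : UpperPair N → ℝ, (∑ p, x p) ^ 2 ∂ν = n := by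
    rw [← hvar, variance_of_integral_eq_zero]
    · simp
    · exact (by simpa [Finset.sum_fn] using hS.aestronglyMeasurable.aemeasurable)
    · simp only [Finset.sum_apply]
      rw [integral_finsetSum _ fun p _ => (hlp p).integrable one_le_two]
      simp [hmean]
  have habs := integral_abs_le_sqrt_integral_sq hS
  rw [hS2] at habs
  refine ⟨?_, ?_⟩
  · simp only [upperMean_eq_inv_card_mul]
    exact (hS.integrable one_le_two).const_mul _
  · simp only [upperMean_eq_inv_card_mul, abs_mul, abs_inv, Nat.abs_cast]
    rw [integral_const_mul, ← hn, inv_mul_le_iff₀ hn0]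
    refine habs.trans (Real.sqrt_le_iff.2 ⟨by positivity, ?_⟩)
    have h2 : 2 * n = N * (N + 1) := two_mul_card_upperPair N
    have hNn : (N : ℝ) ^ 2 ≤ 2 * n := by nlinarith
    have : n * (2 * (N : ℝ)⁻¹) = N + 1 := by
      field_simp
      linarith
    rw [this]
    nlinarith

/-- For `y ≥ 0`, `2 y ^ 3 - 3 y ^ 2 + 1 = (y - 1) ^ 2 (2 y + 1) ≥ 0`; integrate at `y = |Y|`. -/
lemma one_le_integral_abs_pow_three {α : Type*} [MeasurableSpace α] {μ : Measure α}
    [IsProbabilityMeasure μ] {Y : α → ℝ} (h2 : Integrable (fun x => Y x ^ 2) μ)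
    (h3 : Integrable (fun x => |Y x| ^ 3) μ) (h : ∫ x, Y x ^ 2 ∂μ = 1) :
    1 ≤ ∫ x, |Y x| ^ 3 ∂μ := by
  have hle : ∫ x, (3 / 2 * Y x ^ 2 - 1 / 2) ∂μ ≤ ∫ x, |Y x| ^ 3 ∂μ := by
    refine integral_mono ((h2.const_mul _).sub (integrable_const _)) h3 fun x => ?_
    simp only
    rw [← sq_abs]
    nlinarith [mul_nonneg (sq_nonneg (|Y x| - 1)) (abs_nonneg (Y x)), sq_nonneg (|Y x| - 1)]
  rw [integral_sub (h2.const_mul _) (integrable_const _), integral_const_mul, h] at hle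
  simp at hle
  linarith

/-- The comparison for a real-linear functional of the Stieltjes transform, in terms of laws. -/
theorem abs_integral_comp_stieltjes_sub_le (hN : 0 < N) {z : ℂ} (hz : z.im ≠ 0) {g : ℝ → ℝ}
    (hg : ∀ k < 3, Differentiable ℝ (iteratedDeriv k g)) {K₁ K₂ K₃ : ℝ}
    (hK₁ : ∀ x, |iteratedDeriv 1 g x| ≤ K₁) (hK₂ : ∀ x, |iteratedDeriv 2 g x| ≤ K₂)
    (hK₃ : ∀ x, |iteratedDeriv 3 g x| ≤ K₃) {ℓ : ℂ →L[ℝ] ℝ} (hℓ : ∀ w, |ℓ w| ≤ ‖w‖)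
    {μ : Measure (UpperPair N → ℝ)} [IsProbabilityMeasure μ]
    (hμ : ∀ π : Equiv.Perm (UpperPair N),
      MeasurePreserving (fun (x : UpperPair N → ℝ) i => x (π i)) μ μ)
    (h₁ : ∀ᵐ x ∂μ, ∑ k, x k = 0)
    (h₂ : ∀ᵐ x ∂μ, ∑ k, x k ^ 2 = (Fintype.card (UpperPair N) : ℝ)) (p : UpperPair N) {κ : ℝ}
    (hκ : κ = |z.im|⁻¹) :
    |∫ x, g (ℓ (stieltjes (wignerMatrix x) z)) ∂μ -
      ∫ x : UpperPair N → ℝ, g (ℓ (stieltjes (wignerMatrix (centred x)) z))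
        ∂Measure.pi fun _ : UpperPair N => gaussianReal 0 1| ≤
      2 * (4 * K₁ * κ ^ 3 + 2 * K₂ * κ ^ 4) * (N : ℝ)⁻¹ * √(∫ x, x p ^ 4 ∂μ) +
      (6 * K₁ * κ ^ 2 + (8 * K₁ * κ ^ 4 + 8 * K₂ * κ ^ 5 + 8 * K₃ * κ ^ 6) *
        (1 + ∫ t, |t| ^ 3 ∂gaussianReal 0 1)) *
        (N : ℝ) ^ (-1 / 2 : ℝ) * ∫ x, |x p| ^ 3 ∂μ := by
  have hK₁0 : 0 ≤ K₁ := (abs_nonneg _).trans (hK₁ 0)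
  have hK₂0 : 0 ≤ K₂ := (abs_nonneg _).trans (hK₂ 0)
  have hK₃0 : 0 ≤ K₃ := (abs_nonneg _).trans (hK₃ 0)
  have hκ0 : 0 ≤ κ := by rw [hκ]; positivity
  have hN1 : (1 : ℝ) ≤ N := by exact_mod_cast hN
  set s : ℝ := (N : ℝ) ^ (-1 / 2 : ℝ) with hs
  have hs0 : 0 ≤ s := by positivity
  have hs2 : (N : ℝ)⁻¹ = s ^ 2 := by
    rw [hs, ← Real.rpow_natCast, ← Real.rpow_mul (by positivity), ← Real.rpow_neg_one]
    norm_num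
  have hNs : N * s ^ 2 = 1 := by rw [← hs2]; field_simp
  set n : ℝ := (Fintype.card (UpperPair N) : ℝ) with hn
  have hn2 : 2 * n = N * (N + 1) := two_mul_card_upperPair N
  have hnN : n ≤ (N : ℝ) ^ 2 := by nlinarith
  have hsn : √n ≤ N := Real.sqrt_le_iff.2 ⟨by positivity, hnN⟩
  set c : ℝ := ∫ t, |t| ^ 3 ∂gaussianReal 0 1 with hc
  have hc0 : 0 ≤ c := integral_nonneg fun t => by positivity
  have hgd : Differentiable ℝ g := by simpa using hg 0 (by norm_num)
  set f : (UpperPair N → ℝ) → ℝ := fun x => g (ℓ (stieltjes (wignerMatrix x) z)) with hf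
  have hfc : Continuous f :=
    hgd.continuous.comp (ℓ.continuous.comp (continuous_stieltjes_wignerMatrix hz))
  have hfM : ∀ x, |f x| ≤ |g 0| + K₁ * κ := fun x => by
    have e1 := abs_sub_le_mul_of_abs_iteratedDeriv_one_le hgd hK₁ 0
      (ℓ (stieltjes (wignerMatrix x) z))
    have e2 : |ℓ (stieltjes (wignerMatrix x) z) - 0| ≤ κ := by
      rw [sub_zero, hκ]
      exact (hℓ _).trans (norm_stieltjes_wignerMatrix_le hN hz x)
    have e3 := abs_sub_abs_le_abs_sub (f x) (g 0)
    have e4 := mul_le_mul_of_nonneg_left e2 hK₁0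
    simp only [hf] at e3 ⊢
    linarith
  obtain ⟨a, b, hab⟩ := hasCoordinateExpansion_comp_stieltjes hN hz hg hK₁ hK₂ hK₃ hℓ hs hκ
  have hlind := abs_integral_sub_integral_pi_le hμ h₁ h₂ memLp_id_gaussianReal_three
    integral_id_gaussianReal integral_sq_gaussianReal_zero_one hfc.measurable hfM hab p
  have hcent : Continuous (centred (N := N)) := by
    unfold centred upperMean
    fun_prop
  set ν := Measure.pi fun _ : UpperPair N => gaussianReal 0 1 with hν
  have hfν : Integrable f ν :=
    Integrable.of_bound (C := |g 0| + K₁ * κ)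
      hfc.measurable.aestronglyMeasurable (.of_forall hfM)
  have hfν' : Integrable (fun x => f (centred x)) ν :=
    Integrable.of_bound (C := |g 0| + K₁ * κ)
      (hfc.comp hcent).measurable.aestronglyMeasurable (.of_forall fun x => hfM _)
  obtain ⟨hmi, hmle⟩ := integral_abs_upperMean_pi_gaussianReal_le hN
  have hgauss : |∫ x, f x ∂ν - ∫ x, f (centred x) ∂ν| ≤ 2 * K₁ * κ ^ 2 * s := by
    rw [← integral_sub hfν hfν', ← Real.norm_eq_abs]
    have hb : ∀ x, ‖f x - f (centred x)‖ ≤ K₁ * (N * s * κ ^ 2) * |upperMean x| := fun x => by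
      have e1 := abs_sub_le_mul_of_abs_iteratedDeriv_one_le hgd hK₁
        (ℓ (stieltjes (wignerMatrix (centred x)) z)) (ℓ (stieltjes (wignerMatrix x) z))
      refine e1.trans ?_
      rw [mul_assoc, abs_sub_comm, ← map_sub, hκ, hs]
      exact mul_le_mul_of_nonneg_left
        ((hℓ _).trans (norm_stieltjes_centred_sub_le hN hz x)) hK₁0
    refine (norm_integral_le_of_norm_le (hmi.abs.const_mul _) (.of_forall hb)).trans ?_
    rw [integral_const_mul]
    calc _ ≤ K₁ * (N * s * κ ^ 2) * (2 * (N : ℝ)⁻¹) := by gcongr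
      _ = 2 * K₁ * κ ^ 2 * s * (N * s ^ 2) := by rw [hs2]; ring
      _ = _ := by rw [hNs, mul_one]
  have hM3 : 1 ≤ ∫ x, |x p| ^ 3 ∂μ :=
    one_le_integral_abs_pow_three (integrable_pow_of_sum_sq_eq_card h₂ p 2)
      (by simpa using (integrable_pow_of_sum_sq_eq_card h₂ p 3).abs)
      (integral_sq_eq_one_of_exchangeable hμ h₂ p)
  set M3 : ℝ := ∫ x, |x p| ^ 3 ∂μ
  set M4 : ℝ := √(∫ x, x p ^ 4 ∂μ)
  have hM4 : 0 ≤ M4 := Real.sqrt_nonneg _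
  set c₂ := 4 * K₁ * κ ^ 3 + 2 * K₂ * κ ^ 4
  set c₃ := 8 * K₁ * κ ^ 4 + 8 * K₂ * κ ^ 5 + 8 * K₃ * κ ^ 6
  have hc₂ : 0 ≤ c₂ := by positivity
  have hc₃ : 0 ≤ c₃ := by positivity
  have t1 : (2 * K₁ * κ ^ 2 * s ^ 3 + c₂ * s ^ 4 * M4) * (2 * √n) ≤
      4 * K₁ * κ ^ 2 * s + 2 * c₂ * s ^ 2 * M4 := by
    calc _ ≤ (2 * K₁ * κ ^ 2 * s ^ 3 + c₂ * s ^ 4 * M4) * (2 * N) := by gcongr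
      _ = (4 * K₁ * κ ^ 2 * s + 2 * c₂ * s ^ 2 * M4) * (N * s ^ 2) := by ring
      _ = _ := by rw [hNs, mul_one]
  have t2 : n * (c₃ * s ^ 5 * (M3 + c)) ≤ c₃ * (1 + c) * s * M3 := by
    calc _ ≤ (N : ℝ) ^ 2 * (c₃ * s ^ 5 * (M3 + c * M3)) := by
          gcongr
          exact le_mul_of_one_le_right hc0 hM3
      _ = c₃ * (1 + c) * s * M3 * (N * s ^ 2) ^ 2 := by ring
      _ = _ := by rw [hNs]; ring
  -- The 6 collects 4 from the first-order terms and 2 from the centring.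
  have t3 : 6 * K₁ * κ ^ 2 * s ≤ 6 * K₁ * κ ^ 2 * s * M3 :=
    le_mul_of_one_le_right (by positivity) hM3
  rw [hs2]
  refine (abs_sub_le _ (∫ x, f x ∂ν) _).trans ((add_le_add hlind hgauss).trans ?_)
  calc _ ≤ 4 * K₁ * κ ^ 2 * s + 2 * c₂ * s ^ 2 * M4 + c₃ * (1 + c) * s * M3 +
        2 * K₁ * κ ^ 2 * s := by gcongr
    _ ≤ 2 * c₂ * s ^ 2 * M4 + (6 * K₁ * κ ^ 2 * s * M3 + c₃ * (1 + c) * s * M3) := by linarith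
    _ = _ := by ring

end Comparison

theorem lemma4p1 (z : ℂ) (hz : z.im ≠ 0) (g : ℝ → ℝ)
    (hg : ∀ k < 3, Differentiable ℝ (iteratedDeriv k g))
    (hgb : ∀ k ∈ Finset.Icc 1 3, ∃ K : ℝ, ∀ x : ℝ, |iteratedDeriv k g x| ≤ K) :
    ∃ C₁ C₂ : ℝ, ∀ (N : ℕ) (hN : 2 ≤ N)
      (Ω : Type*) [MeasurableSpace Ω] (P : Measure Ω) [IsProbabilityMeasure P]
      (Ω' : Type*) [MeasurableSpace Ω'] (P' : Measure Ω') [IsProbabilityMeasure P']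
      (X : UpperPair N → Ω → ℝ) (Z : UpperPair N → Ω' → ℝ),
      Exchangeable X P →
      (∀ᵐ ω ∂P, upperMean (fun p => X p ω) = 0) →
      (∀ᵐ ω ∂P, upperMean (fun p => (X p ω) ^ 2) = 1) →
      (∀ p, HasLaw (Z p) (gaussianReal 0 1) P') →
      iIndepFun Z P' →
      let X₁₂ : Ω → ℝ := X (upperIndex ⟨0, by omega⟩ ⟨1, by omega⟩)
      let mA : Ω → ℂ := fun ω => stieltjes (wignerMatrix fun p => X p ω) z
      let mB : Ω' → ℂ := fun ω => stieltjes (wignerMatrix (centred fun p => Z p ω)) z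
      let bound : ℝ := C₁ * (N : ℝ)⁻¹ * (∫ ω, |X₁₂ ω| ^ 4 ∂P) ^ (1 / 2 : ℝ) +
        C₂ * (N : ℝ) ^ (-1 / 2 : ℝ) * ∫ ω, |X₁₂ ω| ^ 3 ∂P
      |(∫ ω, g (mA ω).re ∂P) - ∫ ω, g (mB ω).re ∂P'| ≤ bound ∧
      |(∫ ω, g (mA ω).im ∂P) - ∫ ω, g (mB ω).im ∂P'| ≤ bound := by
  obtain ⟨K₁, hK₁⟩ := hgb 1 (by simp)
  obtain ⟨K₂, hK₂⟩ := hgb 2 (by simp)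
  obtain ⟨K₃, hK₃⟩ := hgb 3 (by simp)
  refine ⟨2 * (4 * K₁ * |z.im|⁻¹ ^ 3 + 2 * K₂ * |z.im|⁻¹ ^ 4),
    6 * K₁ * |z.im|⁻¹ ^ 2 + (8 * K₁ * |z.im|⁻¹ ^ 4 + 8 * K₂ * |z.im|⁻¹ ^ 5 +
      8 * K₃ * |z.im|⁻¹ ^ 6) * (1 + ∫ t, |t| ^ 3 ∂gaussianReal 0 1), fun N hN Ω _ P _ Ω' _ P' _ X Z hX hX₁ hX₂ hZ hind => ?_⟩
  intro X₁₂ mA mB bound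
  have hN0 : 0 < N := by omega
  have hn0 := card_upperPair_pos hN0
  -- The identity permutation already carries the measurability of the whole vector.
  have hXm : AEMeasurable (fun ω p => X p ω) P := (hX 1).aemeasurable_fst
  set μ : Measure (UpperPair N → ℝ) := P.map fun ω p => X p ω with hμdef
  have : IsProbabilityMeasure μ := Measure.isProbabilityMeasure_map hXm
  have hμ : ∀ π : Equiv.Perm (UpperPair N),
      MeasurePreserving (fun (x : UpperPair N → ℝ) i => x (π i)) μ μ := fun π => by
    have hm : Measurable fun (x : UpperPair N → ℝ) i => x (π i) := by fun_prop
    refine ⟨hm, ?_⟩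
    rw [hμdef, AEMeasurable.map_map_of_aemeasurable hm.aemeasurable hXm]
    exact (hX π).map_eq
  have h₁ : ∀ᵐ x ∂μ, ∑ k, x k = 0 := by
    rw [hμdef, ae_map_iff hXm (measurableSet_eq_fun (by fun_prop) (by fun_prop))]
    filter_upwards [hX₁] with ω hω
    rw [upperMean_eq_inv_card_mul] at hω
    exact (mul_eq_zero.1 hω).resolve_left (inv_ne_zero hn0.ne')
  have h₂ : ∀ᵐ x ∂μ, ∑ k, x k ^ 2 = (Fintype.card (UpperPair N) : ℝ) := by
    rw [hμdef, ae_map_iff hXm (measurableSet_eq_fun (by fun_prop) (by fun_prop))]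
    filter_upwards [hX₂] with ω hω
    rw [upperMean_eq_inv_card_mul, inv_mul_eq_iff_eq_mul₀ hn0.ne', mul_one] at hω
    exact hω
  have hZlaw := iIndepFun.hasLaw_pi hZ hind
  set p : UpperPair N := upperIndex ⟨0, by omega⟩ ⟨1, by omega⟩
  have hgd : Differentiable ℝ g := by simpa using hg 0 (by norm_num)
  have hcent : Continuous (centred (N := N)) := by
    unfold centred upperMean
    fun_prop
  have hM4 : √(∫ x, x p ^ 4 ∂μ) = (∫ ω, |X₁₂ ω| ^ 4 ∂P) ^ (1 / 2 : ℝ) := by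
    rw [hμdef, integral_map hXm ((measurable_pi_apply p).pow_const 4).aestronglyMeasurable,
      Real.sqrt_eq_rpow]
    simp only [Even.pow_abs (n := 4) (by decide)]
    rfl
  have hM3 : ∫ x, |x p| ^ 3 ∂μ = ∫ ω, |X₁₂ ω| ^ 3 ∂P := by
    rw [hμdef, integral_map hXm
      ((measurable_pi_apply p).abs.pow_const 3).aestronglyMeasurable]
  -- Real and imaginary parts are both real-linear functionals bounded by the norm, so one argument
  -- serves both.
  have key : ∀ ℓ : ℂ →L[ℝ] ℝ, (∀ w, |ℓ w| ≤ ‖w‖) →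
      |(∫ ω, g (ℓ (mA ω)) ∂P) - ∫ ω, g (ℓ (mB ω)) ∂P'| ≤ bound := fun ℓ hℓ => by
    have h := abs_integral_comp_stieltjes_sub_le hN0 hz hg hK₁ hK₂ hK₃ hℓ hμ h₁ h₂ p rfl
    have hc : Continuous fun x : UpperPair N → ℝ => g (ℓ (stieltjes (wignerMatrix x) z)) :=
      hgd.continuous.comp (ℓ.continuous.comp (continuous_stieltjes_wignerMatrix hz))
    have hcc : Continuous fun x : UpperPair N → ℝ =>
        g (ℓ (stieltjes (wignerMatrix (centred x)) z)) := hc.comp hcent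
    rw [hμdef, integral_map hXm hc.measurable.aestronglyMeasurable, ← hμdef,
      ← hZlaw.integral_comp hcc.measurable.aestronglyMeasurable] at h
    rwa [hM3, hM4] at h
  exact ⟨key Complex.reCLM Complex.abs_re_le_norm, key Complex.imCLM Complex.abs_im_le_norm⟩
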